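/- Let $\beta>1/2$ and let $g:[0,1]\to\mathbb R$ be the Littlewood–Offord exponential profile $g(x)=-\beta(x\log x-x)$ for $x\in(0,1]$, $g(0)=0$. Put $$\Psi(z)=\tfrac14\operatorname{Re}\bigl(z^2-z\sqrt{z^2-4}\bigr)+\log\Bigl|\frac{z+\sqrt{z^2-4}}2\Bigr|-\tfrac12,\qquad z\in\mathbb C,$$ where $\sqrt{z^2-4}$ is the branch that is holomorphic outside $[-2,2]$ with $\sqrt{z^2-4}\sim z$ as $|z|\to\infty$. For $t>0$, $z\in\mathbb C$ put $f_t(0,z)=g(0)$ and $$f_t(\alpha,z)=g(\alpha)+\alpha\log\sqrt{t\alpha}+\alpha\,\Psi\Bigl(\frac z{\sqrt{t\alpha}}\Bigr)\quad(0<\alpha\le1),\qquad U_t(z)=\sup_{\alpha\in[0,1]}f_t(\alpha,z)-g(1).$$ For $t>0$ let $\nu_t$ be the unique compactly supported probability measure on $\mathbb C$ with logarithmic potential $\int_{\mathbb C}\log|z-y|\,\nu_t(dy)=U_t(z)$ for all $z\in\mathbb C$ (the integral converging absolutely). Let $\nu_0$ be the unique rotationally invariant, compactly supported probability measure on $\mathbb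 C$ with $\int_{\mathbb C}\log|z-y|\,\nu_0(dy)=\sup_{\alpha\in[0,1]}(g(\alpha)+\alpha\log|z|)-g(1)$ for all $z\in\mathbb C\setminus\{0\}$. Then $\nu_0$ and, for every $t\in(0,1)$, $\nu_t$ are well defined (existence and uniqueness), $\nu_0(\{|z|\le r\})=r^{1/\beta}$ for $0<r<1$, and for every $t\in(0,1)$ the following holds. 1. $\nu_t$ is the push-forward of $\nu_0$ under the measurable map $$\tilde T_t(w)=\begin{cases}\sqrt t\,(2\operatorname{Re}w)\,|w|^{(1-2\beta)/(2\beta)},&|w|<t^{\beta/(2\beta-1)},\\ w+t|w|^{1/\beta}/w,&t^{\beta/(2\beta-1)}\le|w|\le1,\\ w+t/w,&|w|>1\end{cases}$$ (the value at the $\nu_0$-null point $w=0$ being $0$). 2. The singular part of $\nu_t$ with respect to Lebesgue measure on $\mathbb C$ is $t^{1/(2\beta-1)}$ times the Wigner semicircle law on the real interval $[-a,a]$, $a=2t^{\beta/(2\beta-1)}$, i.e. the probability measure with density $x\mapsto\frac{2}{\pi a^2}\sqrt{a^2-x^2}$ on that interval. 3. The absolutely continuous part of $\nu_t$ with respect to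 Lebesgue measure on $\mathbb C$ is the push-forward of the restriction of $\nu_0$ to the annulus $\{t^{\beta/(2\beta-1)}<|w|<1\}$ under the map $w\mapsto w+t|w|^{1/\beta}/w$. -/

import Mathlib

open MeasureTheory Set

noncomputable section

namespace HeatFlow

/-- The branch of `√(z² - 4)` that is holomorphic outside the cut `[-2, 2]` and satisfies
`√(z² - 4) ∼ z` as `|z| → ∞`: the product of the principal roots of `z - 2` and `z + 2`. -/
def sqrtSqSubFour (z : ℂ) : ℂ :=
  (z - 2) ^ (1 / 2 : ℂ) * (z + 2) ^ (1 / 2 : ℂ)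

/-- `Ψ(z) = ¼ Re (z² - z √(z² - 4)) + log |(z + √(z² - 4)) / 2| - ½`. -/
def Psi (z : ℂ) : ℝ :=
  (1 / 4) * (z ^ 2 - z * sqrtSqSubFour z).re
    + Real.log ‖(z + sqrtSqSubFour z) / 2‖ - 1 / 2

/-- `f_t(α, z) = g(α) + α log √(t α) + α Ψ(z / √(t α))` for `α ∈ (0, 1]`, and
`f_t(0, z) = g(0)`, where `t > 0` and `g` is the exponential profile. -/
def heatFunctional (g : ℝ → ℝ) (t α : ℝ) (z : ℂ) : ℝ :=
  if α = 0 then g 0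
  else g α + α * Real.log (Real.sqrt (t * α))
    + α * Psi (z / ((Real.sqrt (t * α) : ℝ) : ℂ))

/-- `U_t(z) = sup_{α ∈ [0, 1]} f_t(α, z) - g(1)`, for `t > 0`. -/
def heatPotential (g : ℝ → ℝ) (t : ℝ) (z : ℂ) : ℝ :=
  sSup ((fun α : ℝ => heatFunctional g t α z) '' Icc 0 1) - g 1

/-- `U_0(z) = sup_{α ∈ [0, 1]} (g(α) + α log |z|) - g(1)`, for `z ≠ 0`. -/
def initialPotential (g : ℝ → ℝ) (z : ℂ) : ℝ :=
  sSup ((fun α : ℝ => g α + α * Real.log ‖z‖) '' Icc 0 1) - g 1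

/-- The logarithmic potential `∫ log |z - y| μ(dy)` of `μ` at the point `z` exists, as an
absolutely convergent integral, and equals `u`. -/
def HasLogPotentialAt (μ : Measure ℂ) (z : ℂ) (u : ℝ) : Prop :=
  Integrable (fun y : ℂ => Real.log ‖z - y‖) μ ∧ ∫ y, Real.log ‖z - y‖ ∂μ = u

/-- `ν` is the measure `ν₀` of the exponential profile `g`: the rotationally invariant,
compactly supported probability measure on `ℂ` whose logarithmic potential
on `ℂ \ {0}` is `U_0`. -/
structure IsInitialMeasure (g : ℝ → ℝ) (ν : Measure ℂ) : Prop where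
  isProbabilityMeasure : IsProbabilityMeasure ν
  compactSupport : ∃ K : Set ℂ, IsCompact K ∧ ν Kᶜ = 0
  rotationInvariant : ∀ c : ℂ, ‖c‖ = 1 → ν.map (fun w => c * w) = ν
  logPotential : ∀ z : ℂ, z ≠ 0 → HasLogPotentialAt ν z (initialPotential g z)

/-- `ν` is the measure `ν_t` of the exponential profile `g` at time `t > 0`: the compactly
supported probability measure on `ℂ` whose logarithmic potential is `U_t` everywhere. -/
structure IsHeatMeasure (g : ℝ → ℝ) (t : ℝ) (ν : Measure ℂ) : Prop where
  isProbabilityMeasure : IsProbabilityMeasure ν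
  compactSupport : ∃ K : Set ℂ, IsCompact K ∧ ν Kᶜ = 0
  logPotential : ∀ z : ℂ, HasLogPotentialAt ν z (heatPotential g t z)

/-- The Littlewood--Offord profile `g(x) = -β (x log x - x)`; the convention `Real.log 0 = 0`
gives `g(0) = 0`. -/
def littlewoodOffordProfile (β x : ℝ) : ℝ :=
  -β * (x * Real.log x - x)

/-- The radius `t^{β / (2β - 1)}`. -/
def collapseRadius (β t : ℝ) : ℝ :=
  t ^ (β / (2 * β - 1))

/-- The standard map `w ↦ w + t |w|^{1/β} / w` (for `0 < |w| ≤ 1`). -/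
def transportMap (β t : ℝ) (w : ℂ) : ℂ :=
  w + ((t * ‖w‖ ^ (1 / β) : ℝ) : ℂ) / w

open Classical in
/-- The modified transport map. -/
def modifiedTransportMap (β t : ℝ) (w : ℂ) : ℂ :=
  if ‖w‖ < collapseRadius β t then
    ((Real.sqrt t * (2 * w.re) * ‖w‖ ^ ((1 - 2 * β) / (2 * β)) : ℝ) : ℂ)
  else if ‖w‖ ≤ 1 then transportMap β t w
  else w + (t : ℂ) / w

/-- The Wigner semicircle law on `[-a, a]`, a probability measure on `ℝ` for `a > 0`,
with density `2 √(a² - x²) / (π a²)`. -/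
def semicircleLaw (a : ℝ) : Measure ℝ :=
  (volume.restrict (Icc (-a) a)).withDensity
    (fun x => ENNReal.ofReal (2 * Real.sqrt (a ^ 2 - x ^ 2) / (Real.pi * a ^ 2)))

end HeatFlow

end

/-! Let `w₊`, `w₋` be the roots of `w² - z w + c = 0` with `|w₊| ≥ √c ≥ |w₋|`. Taking `c = tα`, the
`α`-derivative of `α log √(tα) + α Ψ(z/√(tα))` is `log |w₊(tα, z)|` away from the branch point, and
`g' = -β log`. Hence `f_t(α, z)` is the integral over `(0, α)` of `log |w₊(ta, z)| - β log a`. This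
integrand decreases in `a`: `|w₊(c, z)|/√c` decreases in `c`, and `β > 1/2` handles the rest. So the
supremum is the integral of the positive part, and `U_t(z) = ∫₀¹ max(β log a, log |w₊(ta, z)|) da`
(`heatPotential_eq`).

The measure `ν₀` is the law of `a^β e^{iθ}` with `a` and `θ` uniform. On a circle of radius `ρ ≥
√c`, factoring `z - (w + c/w)` over the two roots and applying Jensen's formula shows that `log |z -
(w + c/w)|` has mean `max(log ρ, log |w₊|)` (`integral_log_norm_sub_joukowski`). The modified map
sends the circle of radius `a^β` to the image of a circle of radius `ρ = max(a^β, √(ta))` under `w ↦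
w + ta/w`; raising `ρ` to `√(ta)` does not affect the maximum, because `|w₊| ≥ √(ta)`
(`exists_joukowski_radius`). Averaging over `a` gives exactly `U_t`.

Uniqueness (`measure_ext_of_logPotential`): circle averages of a potential minus its central values
determine the convolution of the measure with `log⁺(r/|x|)`, whose characteristic function does not
vanish at frequencies of size at most `1/r`.

For the Lebesgue decomposition, the collapsed disc projects to the real line, where polar
coordinates turn it into a semicircle law (`map_collapsed_disc`). The annulus is mapped injectively
onto nested ellipses with positive Jacobian, so its image is absolutely continuous
(`absolutelyContinuous_map_annulus`). -/

noncomputable section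

namespace HeatFlow

/-! ### Uniqueness of a measure with given logarithmic potential -/

/-- A jointly measurable function that is bounded above is integrable for a product of finite
measures as soon as its iterated integral exists. -/
theorem integrable_prod_of_le {X Y : Type*} [MeasurableSpace X] [MeasurableSpace Y]
    {μ : Measure X} {ν : Measure Y} [IsFiniteMeasure μ] [IsFiniteMeasure ν] {f : X × Y → ℝ}
    {C : ℝ} (hf : AEStronglyMeasurable f (μ.prod ν)) (hC : ∀ᵐ x ∂μ, ∀ y, f (x, y) ≤ C)
    (hx : ∀ᵐ x ∂μ, Integrable (fun y => f (x, y)) ν)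
    (hI : Integrable (fun x => ∫ y, f (x, y) ∂ν) μ) : Integrable f (μ.prod ν) := by
  -- `C - f` is nonnegative, so the integral of its norm over a fibre is its plain integral, which
  -- is controlled by `hI`.
  have hg : Integrable (fun p => C - f p) (μ.prod ν) := by
    have hgm : AEStronglyMeasurable (fun p => C - f p) (μ.prod ν) :=
      aestronglyMeasurable_const.sub hf
    rw [integrable_prod_iff hgm]
    refine ⟨?_, ?_⟩
    · filter_upwards [hx] with x h
      exact (integrable_const C).sub h
    · have h1 : Integrable (fun x => (∫ _y, C ∂ν) - ∫ y, f (x, y) ∂ν) μ :=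
        (integrable_const _).sub hI
      refine h1.congr ?_
      filter_upwards [hx, hC] with x h h2
      rw [← integral_sub (integrable_const C) h]
      refine integral_congr_ae (Filter.Eventually.of_forall fun y => ?_)
      simp only
      rw [Real.norm_of_nonneg (sub_nonneg.2 (h2 y))]
  have h2 := (integrable_const C).sub hg
  refine h2.congr (Filter.Eventually.of_forall fun p => ?_)
  simp

/-- Jensen's formula for one linear factor. The centre is excluded because of `Real.log 0 = 0`: for
`a = c` the right side would be `max (log r) 0`. -/
theorem circleAverage_log_norm_sub {r : ℝ} (hr : 0 < r) {a c : ℂ} (h : a ≠ c) :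
    Real.circleAverage (fun z => Real.log ‖z - a‖) c r = max (Real.log r) (Real.log ‖c - a‖) := by
  have h0 : 0 < ‖c - a‖ := norm_pos_iff.2 (sub_ne_zero.2 h.symm)
  rw [circleAverage_log_norm_sub_const_eq_log_radius_add_posLog hr.ne', Real.posLog_apply,
    Real.log_mul (inv_ne_zero hr.ne') h0.ne', Real.log_inv, ← max_add_add_left]
  simp

theorem norm_circleMap_sub (c : ℂ) (r θ : ℝ) : ‖circleMap c r θ - c‖ = |r| := by
  simp [circleMap]

theorem circleAverage_eq_setIntegral (f : ℂ → ℝ) (c : ℂ) (r : ℝ) :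
    Real.circleAverage f c r =
      (2 * Real.pi)⁻¹ * ∫ θ in Ioo (-Real.pi) Real.pi, f (circleMap c r θ) := by
  have hper : (fun θ => f (circleMap c r θ)).Periodic (2 * Real.pi) :=
    fun x => by simp [periodic_circleMap c r x]
  have h := hper.intervalIntegral_add_eq 0 (-Real.pi)
  rw [Real.circleAverage_def, smul_eq_mul]
  congr 1
  have e : -Real.pi + 2 * Real.pi = Real.pi := by ring
  rw [zero_add, e] at h
  rw [h, intervalIntegral.integral_of_le (by linarith [Real.pi_pos]), integral_Ioc_eq_integral_Ioo]

theorem circleIntegrable_log_norm_sub_on_Ioo (c a : ℂ) (r : ℝ) :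
    IntegrableOn (fun θ => Real.log ‖circleMap c r θ - a‖) (Ioo (-Real.pi) Real.pi) := by
  have h : CircleIntegrable (fun z => Real.log ‖z - a‖) c r :=
    circleIntegrable_log_norm_sub_const (a := a) (c := c) r
  have hper : (fun θ => Real.log ‖circleMap c r θ - a‖).Periodic (2 * Real.pi) :=
    fun x => by simp [periodic_circleMap c r x]
  have h2 := hper.intervalIntegrable (t := 0) (by positivity) (by simpa [CircleIntegrable] using h)
    (-Real.pi) Real.pi
  rw [intervalIntegrable_iff_integrableOn_Ioo_of_le (by linarith [Real.pi_pos])] at h2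
  exact h2

/-- The kernel `log⁺ (r / |x|)`, with an arbitrary value at `x = 0`. -/
def logKernel (r : ℝ) (x : ℂ) : ℝ :=
  max (Real.log r) (Real.log ‖x‖) - Real.log ‖x‖

theorem logKernel_nonneg (r : ℝ) (x : ℂ) : 0 ≤ logKernel r x :=
  sub_nonneg.2 (le_max_right _ _)

theorem measurable_logKernel (r : ℝ) : Measurable (logKernel r) := by
  unfold logKernel
  fun_prop

theorem logKernel_eq_zero {r : ℝ} (hr : 0 < r) {x : ℂ} (hx : r ≤ ‖x‖) : logKernel r x = 0 := by
  unfold logKernel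
  rw [max_eq_right (Real.log_le_log hr hx), sub_self]

theorem logKernel_pos {r : ℝ} {x : ℂ} (h0 : x ≠ 0) (hx : ‖x‖ < r) :
    0 < logKernel r x := by
  unfold logKernel
  have := Real.log_lt_log (norm_pos_iff.2 h0) hx
  rw [max_eq_left this.le]
  linarith

/-- The finite measure with density `log⁺ (r / |x|)`. -/
def kernelMeasure (r : ℝ) : Measure ℂ :=
  volume.withDensity fun x => ENNReal.ofReal (logKernel r x)

/-- In polar coordinates the integrand is `ρ log (r/ρ) ≤ r`, by `log x ≤ x - 1`. -/
theorem kernelMeasure_univ_lt_top {r : ℝ} (hr : 0 < r) : kernelMeasure r univ < ⊤ := by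
  rw [kernelMeasure, withDensity_apply _ MeasurableSet.univ, Measure.restrict_univ,
    ← Complex.lintegral_comp_polarCoord_symm]
  have hb : ∀ p ∈ polarCoord.target, ENNReal.ofReal p.1 •
      ENNReal.ofReal (logKernel r (Complex.polarCoord.symm p)) ≤
      (Ioo 0 r ×ˢ Ioo (-Real.pi) Real.pi).indicator (fun _ => ENNReal.ofReal r) p := by
    rintro ⟨ρ, θ⟩ ⟨h1, h2⟩
    have hρ : 0 < ρ := h1
    have hn : ‖Complex.polarCoord.symm (ρ, θ)‖ = ρ := by
      rw [Complex.norm_polarCoord_symm, abs_of_pos hρ]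
    by_cases h : ρ < r
    · rw [indicator_of_mem (by exact ⟨⟨hρ, h⟩, h2⟩), smul_eq_mul, ← ENNReal.ofReal_mul hρ.le]
      apply ENNReal.ofReal_le_ofReal
      have hl := Real.log_lt_log hρ h
      rw [logKernel, hn, max_eq_left hl.le, ← Real.log_div hr.ne' hρ.ne']
      have := Real.log_le_sub_one_of_pos (div_pos hr hρ)
      calc ρ * Real.log (r / ρ) ≤ ρ * (r / ρ) := by gcongr; linarith
        _ = r := by field_simp
    · rw [logKernel_eq_zero hr (by rw [hn]; exact not_lt.1 h)]
      simp
  refine (setLIntegral_mono_ae' polarCoord.open_target.measurableSet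
    (Filter.Eventually.of_forall hb)).trans_lt ?_
  refine (setLIntegral_le_lintegral _ _).trans_lt ?_
  rw [lintegral_indicator (measurableSet_Ioo.prod measurableSet_Ioo), setLIntegral_const]
  refine ENNReal.mul_lt_top ENNReal.ofReal_lt_top ?_
  rw [Measure.volume_eq_prod, Measure.prod_prod]
  exact ENNReal.mul_lt_top (by simp) (by simp)

/-- On the support `|x| < r`, so the phase `⟨x, ξ⟩` stays in `[-1, 1]`, where the cosine is
positive. The real part is thus the integral of a positive function against a nonzero measure. -/
theorem charFun_kernelMeasure_ne_zero {r : ℝ} (hr : 0 < r) {ξ : ℂ} (hξ : r * ‖ξ‖ ≤ 1) :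
    charFun (kernelMeasure r) ξ ≠ 0 := by
  have : IsFiniteMeasure (kernelMeasure r) := ⟨kernelMeasure_univ_lt_top hr⟩
  have hint : Integrable (fun x : ℂ => Complex.exp ((inner ℝ x ξ : ℝ) * Complex.I))
      (kernelMeasure r) := by
    refine Integrable.of_bound (C := 1) (by fun_prop) (Filter.Eventually.of_forall fun x => ?_)
    rw [Complex.norm_exp_ofReal_mul_I]
  intro h0
  have hre : ∫ x : ℂ, Real.cos (inner ℝ x ξ) ∂(kernelMeasure r) = 0 := by
    have := congrArg Complex.re h0
    rw [charFun_apply] at this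
    have h2 := integral_re hint
    simp only [RCLike.re_eq_complex_re] at h2
    rw [← h2] at this
    simpa only [Complex.exp_ofReal_mul_I_re, Complex.zero_re] using this
  have hball : ∀ᵐ x ∂(kernelMeasure r), 0 < Real.cos (inner ℝ x ξ) := by
    rw [kernelMeasure, ae_withDensity_iff (measurable_logKernel r).ennreal_ofReal]
    refine Filter.Eventually.of_forall fun x hx => ?_
    have hxr : ‖x‖ < r := by
      by_contra hc
      exact hx (by rw [logKernel_eq_zero hr (not_lt.1 hc), ENNReal.ofReal_zero])
    have h1 : |inner ℝ x ξ| ≤ 1 := (abs_real_inner_le_norm x ξ).trans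
      ((mul_le_mul_of_nonneg_right hxr.le (norm_nonneg _)).trans hξ)
    apply Real.cos_pos_of_mem_Ioo
    constructor <;> linarith [abs_le.1 h1, (abs_le.1 h1).1, (abs_le.1 h1).2, Real.pi_gt_three]
  have hcos : Integrable (fun x : ℂ => Real.cos (inner ℝ x ξ)) (kernelMeasure r) := by
    refine Integrable.of_bound (C := 1) (by fun_prop) (Filter.Eventually.of_forall fun x => ?_)
    exact Real.abs_cos_le_one _
  rw [integral_eq_zero_iff_of_nonneg_ae (hball.mono fun x hx => hx.le) hcos] at hre
  have hz : kernelMeasure r = 0 := by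
    rw [← ae_eq_bot, ← Filter.eventually_false_iff_eq_bot]
    filter_upwards [hball, hre] with x h1 h2
    exact h1.ne' h2
  have hpos : kernelMeasure r (Metric.ball 0 r \ {0}) ≠ 0 := by
    intro h
    rw [kernelMeasure, withDensity_apply_eq_zero (measurable_logKernel r).ennreal_ofReal] at h
    have h3 : {x | ENNReal.ofReal (logKernel r x) ≠ 0} ∩ (Metric.ball 0 r \ {0}) =
        Metric.ball 0 r \ {0} := by
      apply inter_eq_right.2
      rintro x ⟨hx, hx0⟩
      have := logKernel_pos (r := r) (x := x) hx0 (by simpa using hx)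
      simpa using this
    rw [h3, measure_sdiff_null (by simp)] at h
    exact (Metric.measure_ball_pos volume (0 : ℂ) hr).ne' h
  exact hpos (by rw [hz]; simp)

/-- The circle average of a logarithmic potential. -/
theorem circleAverage_logPotential {μ : Measure ℂ} [IsFiniteMeasure μ] {K : Set ℂ}
    (hK : IsCompact K) (hμK : μ Kᶜ = 0) {c : ℂ} {r : ℝ} (hr : 0 < r)
    (hc : ∀ᵐ y ∂μ, y ≠ c) {u : ℂ → ℝ} (hu : ∀ z, ‖z - c‖ = r → HasLogPotentialAt μ z (u z)) :
    Integrable (fun y => max (Real.log r) (Real.log ‖c - y‖)) μ ∧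
    Real.circleAverage u c r = ∫ y, max (Real.log r) (Real.log ‖c - y‖) ∂μ := by
  obtain ⟨M, hM⟩ := hK.isBounded.exists_norm_le
  have hKae : ∀ᵐ y ∂μ, y ∈ K := by rw [ae_iff]; exact hμK
  have hb : ∀ᵐ y ∂μ, ‖y‖ ≤ M := hKae.mono fun y hy => hM y hy
  have hmeas : AEStronglyMeasurable (fun y => max (Real.log r) (Real.log ‖c - y‖)) μ := by
    apply Measurable.aestronglyMeasurable
    fun_prop
  have hM0 : ∀ᵐ y ∂μ, 0 ≤ M := hb.mono fun y hy => (norm_nonneg y).trans hy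
  have hint : Integrable (fun y => max (Real.log r) (Real.log ‖c - y‖)) μ := by
    refine Integrable.of_bound (C := |Real.log r| + (‖c‖ + M)) hmeas ?_
    filter_upwards [hb, hM0] with y hy h0
    have h1 : Real.log ‖c - y‖ ≤ ‖c‖ + M :=
      (Real.log_le_self (norm_nonneg _)).trans ((norm_sub_le _ _).trans (by linarith))
    have := norm_nonneg c
    rw [Real.norm_eq_abs, abs_le]
    constructor
    · linarith [neg_abs_le (Real.log r), le_max_left (Real.log r) (Real.log ‖c - y‖)]
    · apply max_le <;> linarith [le_abs_self (Real.log r), abs_nonneg (Real.log r)]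
  refine ⟨hint, ?_⟩
  set ν : Measure ℝ := volume.restrict (Ioo (-Real.pi) Real.pi) with hν
  have hcirc : ∀ y : ℂ, ∫ θ, Real.log ‖circleMap c r θ - y‖ ∂ν =
      2 * Real.pi * Real.circleAverage (fun z => Real.log ‖z - y‖) c r := by
    intro y
    rw [circleAverage_eq_setIntegral, ← mul_assoc, mul_inv_cancel₀ (by positivity), one_mul]
  -- On the compact support the logarithm is bounded above, and its singularity below is tamed by
  -- integrating over the circle first, which justifies Fubini.
  have hprod : Integrable (fun p : ℂ × ℝ => Real.log ‖circleMap c r p.2 - p.1‖) (μ.prod ν) := by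
    refine integrable_prod_of_le (C := ‖c‖ + r + M) ?_ ?_ ?_ ?_
    · apply Measurable.aestronglyMeasurable
      have : Measurable fun p : ℂ × ℝ => circleMap c r p.2 :=
        ((continuous_circleMap c r).measurable).comp measurable_snd
      fun_prop
    · filter_upwards [hb] with y hy θ
      refine (Real.log_le_self (norm_nonneg _)).trans ((norm_sub_le _ _).trans ?_)
      have : ‖circleMap c r θ‖ ≤ ‖c‖ + r := by
        have h := norm_add_le c (circleMap c r θ - c)
        rw [add_sub_cancel, norm_circleMap_sub, abs_of_pos hr] at h
        exact h
      linarith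
    · exact Filter.Eventually.of_forall fun y => circleIntegrable_log_norm_sub_on_Ioo c y r
    · refine (hint.const_mul (2 * Real.pi)).congr ?_
      filter_upwards [hc] with y hy
      rw [hcirc, circleAverage_log_norm_sub hr hy]
  have hswap := integral_integral_swap
    (f := fun (y : ℂ) (θ : ℝ) => Real.log ‖circleMap c r θ - y‖) hprod
  rw [circleAverage_eq_setIntegral]
  have h1 : ∫ θ in Ioo (-Real.pi) Real.pi, u (circleMap c r θ) =
      ∫ θ, ∫ y, Real.log ‖circleMap c r θ - y‖ ∂μ ∂ν := by
    rw [hν]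
    refine integral_congr_ae (Filter.Eventually.of_forall fun θ => ?_)
    exact (hu _ (by rw [norm_circleMap_sub, abs_of_pos hr])).2.symm
  rw [h1, ← hswap, ← integral_const_mul]
  refine integral_congr_ae ?_
  filter_upwards [hc] with y hy
  rw [hcirc, circleAverage_log_norm_sub hr hy, ← mul_assoc, inv_mul_cancel₀ (by positivity),
    one_mul]

/-- The mean of `log |z - y|` over the circle is `max(log r, log |c - y|)`; subtracting the value at
the centre leaves the kernel. Hence the smoothed measure depends on the potential alone. -/
theorem lintegral_logKernel_sub {μ : Measure ℂ} [IsFiniteMeasure μ] {K : Set ℂ}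
    (hK : IsCompact K) (hμK : μ Kᶜ = 0) {c : ℂ} {r : ℝ} (hr : 0 < r)
    (hc : ∀ᵐ y ∂μ, y ≠ c) {u : ℂ → ℝ} (hu : ∀ z, ‖z - c‖ = r → HasLogPotentialAt μ z (u z))
    (huc : HasLogPotentialAt μ c (u c)) :
    ∫⁻ y, ENNReal.ofReal (logKernel r (c - y)) ∂μ =
      ENNReal.ofReal (Real.circleAverage u c r - u c) := by
  obtain ⟨h1, h2⟩ := circleAverage_logPotential hK hμK hr hc hu
  rw [h2, ← huc.2, ← integral_sub h1 huc.1]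
  exact (ofReal_integral_eq_lintegral_ofReal (h1.sub huc.1)
    (Filter.Eventually.of_forall fun y => logKernel_nonneg r (c - y))).symm

theorem conv_kernelMeasure (μ : Measure ℂ) [IsFiniteMeasure μ] {r : ℝ} (hr : 0 < r) :
    Measure.conv μ (kernelMeasure r) =
      volume.withDensity fun c => ∫⁻ y, ENNReal.ofReal (logKernel r (c - y)) ∂μ := by
  have : IsFiniteMeasure (kernelMeasure r) := ⟨kernelMeasure_univ_lt_top hr⟩
  have hk := (measurable_logKernel r).ennreal_ofReal
  ext A hA
  rw [withDensity_apply _ hA, ← lintegral_indicator_one hA,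
    Measure.lintegral_conv (measurable_one.indicator hA)]
  have h1 : ∀ y : ℂ, ∫⁻ x, A.indicator (1 : ℂ → ENNReal) (y + x) ∂(kernelMeasure r) =
      ∫⁻ c in A, ENNReal.ofReal (logKernel r (c - y)) := by
    intro y
    have hm : Measurable fun x : ℂ => A.indicator (1 : ℂ → ENNReal) (y + x) :=
      (measurable_one.indicator hA).comp (measurable_const_add y)
    rw [kernelMeasure, lintegral_withDensity_eq_lintegral_mul _ hk hm,
      ← lintegral_indicator hA, ← lintegral_sub_right_eq_self _ y]
    refine lintegral_congr fun c => ?_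
    by_cases hc : c ∈ A <;> simp [hc]
  simp_rw [h1]
  rw [lintegral_lintegral_swap]
  apply Measurable.aemeasurable
  exact hk.comp (measurable_snd.sub measurable_fst)

/-- A compactly supported finite measure is determined by its logarithmic potential away from the
origin. -/
theorem measure_ext_of_logPotential {μ ν : Measure ℂ} [IsFiniteMeasure μ] [IsFiniteMeasure ν]
    (hμ : ∃ K : Set ℂ, IsCompact K ∧ μ Kᶜ = 0) (hν : ∃ K : Set ℂ, IsCompact K ∧ ν Kᶜ = 0)
    {u : ℂ → ℝ} (huμ : ∀ z ≠ 0, HasLogPotentialAt μ z (u z))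
    (huν : ∀ z ≠ 0, HasLogPotentialAt ν z (u z)) : μ = ν := by
  obtain ⟨K, hK, hμK⟩ := hμ
  obtain ⟨K', hK', hνK⟩ := hν
  -- By Fubini, almost no centre is an atom of `κ`.
  have hdiag : ∀ (κ : Measure ℂ) [IsFiniteMeasure κ], ∀ᵐ c : ℂ, ∀ᵐ y ∂κ, y ≠ c := by
    intro κ _
    rw [Measure.ae_ae_comm]
    · refine Filter.Eventually.of_forall fun y => ?_
      rw [ae_iff]
      simp
    · exact (measurableSet_eq_fun measurable_snd measurable_fst).compl
  have hconv : ∀ r : ℝ, 0 < r →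
      Measure.conv μ (kernelMeasure r) = Measure.conv ν (kernelMeasure r) := by
    intro r hr
    rw [conv_kernelMeasure μ hr, conv_kernelMeasure ν hr]
    apply withDensity_congr_ae
    -- The circle of radius `r` about `c` must avoid the origin, where no potential is prescribed.
    have hsph : ∀ᵐ c : ℂ, c ∉ Metric.sphere (0 : ℂ) r :=
      measure_eq_zero_iff_ae_notMem.1 (Measure.addHaar_sphere volume (0 : ℂ) r)
    have h0 : ∀ᵐ c : ℂ, c ≠ 0 := by
      rw [ae_iff]
      simp
    filter_upwards [hdiag μ, hdiag ν, hsph, h0] with c h1 h2 h3 h4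
    have h5 : ∀ z : ℂ, ‖z - c‖ = r → z ≠ 0 := by
      rintro z hz rfl
      exact h3 (by simpa using hz)
    rw [lintegral_logKernel_sub hK hμK hr h1 (fun z hz => huμ z (h5 z hz)) (huμ c h4),
      lintegral_logKernel_sub hK' hνK hr h2 (fun z hz => huν z (h5 z hz)) (huν c h4)]
  apply Measure.ext_of_charFun
  ext ξ
  -- The smoothing radius is adapted to the frequency, so that `r ‖ξ‖ ≤ 1` and the kernel factor can
  -- be cancelled.
  have hr : (0 : ℝ) < (1 + ‖ξ‖)⁻¹ := by positivity
  have : IsFiniteMeasure (kernelMeasure (1 + ‖ξ‖)⁻¹) := ⟨kernelMeasure_univ_lt_top hr⟩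
  have h := congrArg (fun κ => charFun κ ξ) (hconv _ hr)
  simp only [charFun_conv] at h
  refine mul_right_cancel₀ (charFun_kernelMeasure_ne_zero hr ?_) h
  rw [inv_mul_le_iff₀ (by positivity)]
  linarith [norm_nonneg ξ]

/-! ### The two roots of `w² - z w + c` -/

theorem cpow_half_sq (x : ℂ) : (x ^ (1 / 2 : ℂ)) ^ 2 = x := by
  rw [one_div, Complex.cpow_ofNat_inv_pow]

theorem cpow_half_re_nonneg (x : ℂ) : 0 ≤ (x ^ (1 / 2 : ℂ)).re := by
  rcases eq_or_ne x 0 with rfl | hx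
  · simp
  rw [Complex.cpow_def_of_ne_zero hx, Complex.exp_re]
  have e : (Complex.log x * (1 / 2)).im = x.arg / 2 := by
    simp [Complex.mul_im, Complex.log_im]; ring
  rw [e]
  have := Complex.neg_pi_lt_arg x
  have := Complex.arg_le_pi x
  exact mul_nonneg (Real.exp_pos _).le
    (Real.cos_nonneg_of_mem_Icc ⟨by linarith, by linarith⟩)

theorem cpow_half_im_nonneg {x : ℂ} (h : 0 ≤ x.im) : 0 ≤ (x ^ (1 / 2 : ℂ)).im := by
  rcases eq_or_ne x 0 with rfl | hx
  · simp
  rw [Complex.cpow_def_of_ne_zero hx, Complex.exp_im]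
  have e : (Complex.log x * (1 / 2)).im = x.arg / 2 := by
    simp [Complex.mul_im, Complex.log_im]; ring
  rw [e]
  have := Complex.arg_nonneg_iff.2 h
  have := Complex.arg_le_pi x
  exact mul_nonneg (Real.exp_pos _).le
    (Real.sin_nonneg_of_nonneg_of_le_pi (by linarith) (by linarith [Real.pi_pos]))

theorem cpow_half_im_nonpos {x : ℂ} (h : x.im < 0) : (x ^ (1 / 2 : ℂ)).im ≤ 0 := by
  by_contra hc
  have h1 := congrArg Complex.im (cpow_half_sq x)
  rw [pow_two, Complex.mul_im] at h1
  nlinarith [cpow_half_re_nonneg x]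

/-- The principal root jumps across the negative axis of `ℂ`, but along the real line it is `√x + i
√(-x)`. -/
theorem continuous_ofReal_cpow_half : Continuous fun x : ℝ => (x : ℂ) ^ (1 / 2 : ℂ) := by
  have h : (fun x : ℝ => (x : ℂ) ^ (1 / 2 : ℂ)) =
      fun x : ℝ => (Real.sqrt x : ℂ) + (Real.sqrt (-x) : ℂ) * Complex.I := by
    have key : ∀ y : ℝ, 0 ≤ y → (y : ℂ) ^ (1 / 2 : ℂ) = (Real.sqrt y : ℂ) := by
      intro y hy
      rw [Real.sqrt_eq_rpow, Complex.ofReal_cpow hy]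
      norm_num
    funext x
    rcases le_total 0 x with hx | hx
    · rw [key x hx, Real.sqrt_eq_zero_of_nonpos (neg_nonpos.2 hx)]
      simp
    · rw [Complex.ofReal_cpow_of_nonpos hx, ← Complex.ofReal_neg, key _ (neg_nonneg.2 hx),
        Real.sqrt_eq_zero_of_nonpos hx]
      have : (Real.pi : ℂ) * Complex.I * (1 / 2) = Real.pi / 2 * Complex.I := by ring
      rw [this, Complex.exp_pi_div_two_mul_I]
      simp
  rw [h]
  fun_prop

/-- The solution `u` of `u + u⁻¹ = q` outside the unit disc. -/
def outerRoot (q : ℂ) : ℂ := (q + sqrtSqSubFour q) / 2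

/-- The solution `u` of `u + u⁻¹ = q` inside the unit disc. -/
def innerRoot (q : ℂ) : ℂ := (q - sqrtSqSubFour q) / 2

theorem sqrtSqSubFour_sq (q : ℂ) : sqrtSqSubFour q ^ 2 = q ^ 2 - 4 := by
  rw [sqrtSqSubFour, mul_pow, cpow_half_sq, cpow_half_sq]
  ring

theorem outerRoot_mul_innerRoot (q : ℂ) : outerRoot q * innerRoot q = 1 := by
  unfold outerRoot innerRoot
  linear_combination (-1 / 4 : ℂ) * sqrtSqSubFour_sq q

theorem outerRoot_add_innerRoot (q : ℂ) : outerRoot q + innerRoot q = q := by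
  unfold outerRoot innerRoot
  ring

theorem outerRoot_eq_sq (q : ℂ) :
    outerRoot q = ((q - 2) ^ (1 / 2 : ℂ) + (q + 2) ^ (1 / 2 : ℂ)) ^ 2 / 4 := by
  unfold outerRoot sqrtSqSubFour
  linear_combination (-1 / 4 : ℂ) * (cpow_half_sq (q - 2) + cpow_half_sq (q + 2))

theorem innerRoot_eq_sq (q : ℂ) :
    innerRoot q = ((q - 2) ^ (1 / 2 : ℂ) - (q + 2) ^ (1 / 2 : ℂ)) ^ 2 / 4 := by
  unfold innerRoot sqrtSqSubFour
  linear_combination (-1 / 4 : ℂ) * (cpow_half_sq (q - 2) + cpow_half_sq (q + 2))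

/-- With `a`, `b` the principal roots of `q ∓ 2`, the claim is `|a - b| ≤ |a + b|`, i.e. `Re (a b̄)
≥ 0`. Both real parts are nonnegative, and the imaginary parts have no opposite signs since `q - 2`
and `q + 2` share their imaginary part. -/
theorem norm_innerRoot_le_norm_outerRoot (q : ℂ) : ‖innerRoot q‖ ≤ ‖outerRoot q‖ := by
  rw [innerRoot_eq_sq, outerRoot_eq_sq, norm_div, norm_div, norm_pow, norm_pow]
  set a := (q - 2) ^ (1 / 2 : ℂ)
  set b := (q + 2) ^ (1 / 2 : ℂ)
  have hab : 0 ≤ a.re * b.re + a.im * b.im := by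
    have h1 : 0 ≤ a.re * b.re := mul_nonneg (cpow_half_re_nonneg _) (cpow_half_re_nonneg _)
    have h2 : 0 ≤ a.im * b.im := by
      rcases le_or_gt 0 q.im with h | h
      · exact mul_nonneg (cpow_half_im_nonneg (by simpa using h))
          (cpow_half_im_nonneg (by simpa using h))
      · exact mul_nonneg_of_nonpos_of_nonpos (cpow_half_im_nonpos (by simpa using h))
          (cpow_half_im_nonpos (by simpa using h))
    linarith
  gcongr ?_ / _
  rw [← Complex.normSq_eq_norm_sq, ← Complex.normSq_eq_norm_sq, Complex.normSq_apply,
    Complex.normSq_apply]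
  simp only [Complex.sub_re, Complex.sub_im, Complex.add_re, Complex.add_im]
  nlinarith

theorem norm_outerRoot_mul_norm_innerRoot (q : ℂ) : ‖outerRoot q‖ * ‖innerRoot q‖ = 1 := by
  rw [← norm_mul, outerRoot_mul_innerRoot, norm_one]

theorem one_le_norm_outerRoot (q : ℂ) : 1 ≤ ‖outerRoot q‖ := by
  by_contra h
  nlinarith [norm_innerRoot_le_norm_outerRoot q, norm_outerRoot_mul_norm_innerRoot q,
    norm_nonneg (innerRoot q), norm_nonneg (outerRoot q)]

theorem norm_innerRoot_le_one (q : ℂ) : ‖innerRoot q‖ ≤ 1 := by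
  nlinarith [one_le_norm_outerRoot q, norm_outerRoot_mul_norm_innerRoot q,
    norm_nonneg (innerRoot q)]

/-- The parallelogram law for the square roots of `q ∓ 2`. It expresses the modulus of the root
through an ellipse with foci `±2`. -/
theorem norm_outerRoot_add_norm_innerRoot (q : ℂ) :
    ‖outerRoot q‖ + ‖innerRoot q‖ = (‖q - 2‖ + ‖q + 2‖) / 2 := by
  rw [innerRoot_eq_sq, outerRoot_eq_sq, norm_div, norm_div, norm_pow, norm_pow]
  have h := parallelogram_law_with_norm ℝ ((q - 2) ^ (1 / 2 : ℂ)) ((q + 2) ^ (1 / 2 : ℂ))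
  have h1 : ‖(q - 2) ^ (1 / 2 : ℂ)‖ ^ 2 = ‖q - 2‖ := by
    rw [← norm_pow, cpow_half_sq]
  have h2 : ‖(q + 2) ^ (1 / 2 : ℂ)‖ ^ 2 = ‖q + 2‖ := by
    rw [← norm_pow, cpow_half_sq]
  rw [h1, h2] at h
  have h4 : ‖(4 : ℂ)‖ = 4 := by norm_num
  rw [h4]
  linarith

/-- The sum of distances to the foci grows along rays from the centre: each `l (q ∓ 2)` is a
combination of `l q ∓ 2` and `l q ± 2`, and the coefficients' moduli add up to `l` over the two
estimates. -/
theorem norm_sub_add_norm_add_mono {l : ℝ} (hl : 1 ≤ l) (q : ℂ) :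
    ‖q - 2‖ + ‖q + 2‖ ≤ ‖l * q - 2‖ + ‖l * q + 2‖ := by
  have hl0 : 0 < l := by linarith
  have e : ∀ x : ℂ, ‖(l : ℂ) * x‖ = l * ‖x‖ := fun x => by
    rw [norm_mul, Complex.norm_of_nonneg hl0.le]
  have h1 : l * ‖q - 2‖ ≤ (l + 1) / 2 * ‖l * q - 2‖ + (l - 1) / 2 * ‖l * q + 2‖ := by
    rw [← e]
    have h : (l : ℂ) * (q - 2) =
        (((l + 1) / 2 : ℝ) : ℂ) * (l * q - 2) - (((l - 1) / 2 : ℝ) : ℂ) * (l * q + 2) := by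
      push_cast; ring
    rw [h]
    refine (norm_sub_le _ _).trans_eq ?_
    rw [norm_mul, norm_mul, Complex.norm_of_nonneg (by linarith),
      Complex.norm_of_nonneg (by linarith)]
  have h2 : l * ‖q + 2‖ ≤ (l - 1) / 2 * ‖l * q - 2‖ + (l + 1) / 2 * ‖l * q + 2‖ := by
    rw [← e]
    have h : (l : ℂ) * (q + 2) =
        (((l + 1) / 2 : ℝ) : ℂ) * (l * q + 2) - (((l - 1) / 2 : ℝ) : ℂ) * (l * q - 2) := by
      push_cast; ring
    rw [h]
    refine (norm_sub_le _ _).trans_eq ?_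
    rw [norm_mul, norm_mul, Complex.norm_of_nonneg (by linarith),
      Complex.norm_of_nonneg (by linarith)]
    ring
  have h3 : l * (‖q - 2‖ + ‖q + 2‖) ≤ l * (‖l * q - 2‖ + ‖l * q + 2‖) := by linarith
  exact le_of_mul_le_mul_left h3 hl0

theorem norm_outerRoot_mono {l : ℝ} (hl : 1 ≤ l) (q : ℂ) :
    ‖outerRoot q‖ ≤ ‖outerRoot (l * q)‖ := by
  have h := norm_sub_add_norm_add_mono hl q
  have h1 := norm_outerRoot_add_norm_innerRoot q
  have h2 := norm_outerRoot_add_norm_innerRoot (l * q)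
  have h3 := norm_outerRoot_mul_norm_innerRoot q
  have h4 := norm_outerRoot_mul_norm_innerRoot (l * q)
  have h5 := one_le_norm_outerRoot q
  have h6 := one_le_norm_outerRoot (l * q)
  have h7 := norm_innerRoot_le_one (l * q)
  generalize ‖outerRoot q‖ = a at *
  generalize ‖innerRoot q‖ = b at *
  generalize ‖outerRoot (l * q)‖ = a' at *
  generalize ‖innerRoot (l * q)‖ = b' at *
  by_contra! hc
  have hb : b < 1 := by nlinarith
  have hb0 : 0 < b := by nlinarith
  -- If `a' < a`, then `a + b ≤ a' + b'` gives `a - a' ≤ b' - b = b b' (a - a')`, impossible for `b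
  -- b' < 1`.
  have h8 : b' - b = b * b' * (a - a') := by linear_combination -b' * h3 + b * h4
  have h9 : b * b' < 1 := by nlinarith
  nlinarith

theorem Psi_eq (q : ℂ) : Psi q = Real.log ‖outerRoot q‖ + (innerRoot q ^ 2).re / 2 := by
  have h : q ^ 2 - q * sqrtSqSubFour q = 2 + 2 * innerRoot q ^ 2 := by
    unfold innerRoot
    linear_combination (-1 / 2 : ℂ) * sqrtSqSubFour_sq q
  unfold Psi
  rw [h]
  simp only [Complex.add_re, Complex.mul_re, Complex.re_ofNat, Complex.im_ofNat, outerRoot]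
  ring

/-- The root of larger modulus of `w² - z w + c = 0`, for `c > 0`. -/
def largeRoot (c : ℝ) (z : ℂ) : ℂ := Real.sqrt c * outerRoot (z / Real.sqrt c)

/-- The root of smaller modulus of `w² - z w + c = 0`, for `c > 0`. -/
def smallRoot (c : ℝ) (z : ℂ) : ℂ := Real.sqrt c * innerRoot (z / Real.sqrt c)

section Roots

variable {c : ℝ} {z : ℂ}

theorem largeRoot_mul_smallRoot (hc : 0 < c) : largeRoot c z * smallRoot c z = c := by
  have h : (Real.sqrt c : ℂ) * Real.sqrt c = c := by
    rw [← Complex.ofReal_mul, Real.mul_self_sqrt hc.le]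
  unfold largeRoot smallRoot
  linear_combination (c : ℂ) * outerRoot_mul_innerRoot (z / Real.sqrt c) +
    outerRoot (z / Real.sqrt c) * innerRoot (z / Real.sqrt c) * h

theorem largeRoot_add_smallRoot (hc : 0 < c) : largeRoot c z + smallRoot c z = z := by
  unfold largeRoot smallRoot
  rw [← mul_add, outerRoot_add_innerRoot]
  have : (Real.sqrt c : ℂ) ≠ 0 := by
    exact_mod_cast (Real.sqrt_pos.2 hc).ne'
  field_simp

theorem norm_largeRoot (c : ℝ) (z : ℂ) :
    ‖largeRoot c z‖ = Real.sqrt c * ‖outerRoot (z / Real.sqrt c)‖ := by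
  rw [largeRoot, norm_mul, Complex.norm_of_nonneg (Real.sqrt_nonneg c)]

theorem sqrt_le_norm_largeRoot (c : ℝ) (z : ℂ) : Real.sqrt c ≤ ‖largeRoot c z‖ := by
  rw [norm_largeRoot]
  exact le_mul_of_one_le_right (Real.sqrt_nonneg c) (one_le_norm_outerRoot _)

theorem norm_smallRoot_le_sqrt (c : ℝ) (z : ℂ) : ‖smallRoot c z‖ ≤ Real.sqrt c := by
  rw [smallRoot, norm_mul, Complex.norm_of_nonneg (Real.sqrt_nonneg c)]
  exact mul_le_of_le_one_right (Real.sqrt_nonneg c) (norm_innerRoot_le_one _)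

theorem norm_largeRoot_pos (hc : 0 < c) : 0 < ‖largeRoot c z‖ :=
  (Real.sqrt_pos.2 hc).trans_le (sqrt_le_norm_largeRoot c z)

theorem norm_largeRoot_le (hc : 0 < c) : ‖largeRoot c z‖ ≤ ‖z‖ + Real.sqrt c := by
  have h : largeRoot c z = z - smallRoot c z := eq_sub_of_add_eq (largeRoot_add_smallRoot hc)
  rw [h]
  exact (norm_sub_le _ _).trans (by gcongr; exact norm_smallRoot_le_sqrt c z)

/-- `c ↦ log |largeRoot c z| - ½ log c` is decreasing. -/
theorem log_norm_largeRoot_sub_anti {c' : ℝ} (hc : 0 < c) (h : c ≤ c') :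
    Real.log ‖largeRoot c' z‖ - Real.log c' / 2 ≤ Real.log ‖largeRoot c z‖ - Real.log c / 2 := by
  have key : ∀ x : ℝ, 0 < x → Real.log ‖largeRoot x z‖ - Real.log x / 2 =
      Real.log ‖outerRoot (z / Real.sqrt x)‖ := by
    intro x hx
    rw [norm_largeRoot, Real.log_mul (Real.sqrt_pos.2 hx).ne'
      (zero_lt_one.trans_le (one_le_norm_outerRoot _)).ne', Real.log_sqrt hx.le]
    ring
  have hc' := hc.trans_le h
  rw [key c hc, key c' hc']
  apply Real.log_le_log (zero_lt_one.trans_le (one_le_norm_outerRoot _))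
  have hs := Real.sqrt_pos.2 hc
  have hs' := Real.sqrt_pos.2 hc'
  have h1 : 1 ≤ Real.sqrt c' / Real.sqrt c := by
    rw [one_le_div hs]
    exact Real.sqrt_le_sqrt h
  have h2 := norm_outerRoot_mono h1 (z / Real.sqrt c')
  have e : ((Real.sqrt c' / Real.sqrt c : ℝ) : ℂ) * (z / Real.sqrt c') = z / Real.sqrt c := by
    have h3 : (Real.sqrt c : ℂ) ≠ 0 := by exact_mod_cast hs.ne'
    have h4 : (Real.sqrt c' : ℂ) ≠ 0 := by exact_mod_cast hs'.ne'
    push_cast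
    field_simp
  rwa [e] at h2

/-- For real `z` the square roots are taken along the real line, where they are continuous; for
nonreal `z` their arguments never meet the cut. -/
theorem continuousOn_largeRoot (z : ℂ) : ContinuousOn (fun c : ℝ => largeRoot c z) (Ioi 0) := by
  have hroot : ∀ d : ℂ, d.im = 0 →
      ContinuousOn (fun c : ℝ => (z / (Real.sqrt c : ℂ) + d) ^ (1 / 2 : ℂ)) (Ioi 0) := by
    intro d hd
    by_cases hz : z.im = 0
    · have hcont : ContinuousOn (fun c : ℝ => z.re / Real.sqrt c + d.re) (Ioi 0) := by
        refine ContinuousOn.add (ContinuousOn.div continuousOn_const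
          Real.continuous_sqrt.continuousOn fun c hc => ?_) continuousOn_const
        exact (Real.sqrt_pos.2 hc).ne'
      refine (continuous_ofReal_cpow_half.comp_continuousOn hcont).congr fun c _ => ?_
      have h1 : z = (z.re : ℂ) := Complex.ext (by simp) (by simp [hz])
      have h2 : d = (d.re : ℂ) := Complex.ext (by simp) (by simp [hd])
      simp only [Function.comp_apply]
      congr 1
      conv_lhs => rw [h1, h2]
      push_cast
      rfl
    · have hcont : ContinuousOn (fun c : ℝ => z / (Real.sqrt c : ℂ) + d) (Ioi 0) := by
        refine ContinuousOn.add (ContinuousOn.div continuousOn_const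
          (by fun_prop) fun c hc => ?_) continuousOn_const
        exact_mod_cast (Real.sqrt_pos.2 hc).ne'
      refine ContinuousOn.cpow hcont continuousOn_const fun c hc => ?_
      refine Or.inr ?_
      rw [Complex.add_im, Complex.div_ofReal_im, hd, add_zero]
      exact div_ne_zero hz (Real.sqrt_pos.2 hc).ne'
  have h1 := hroot (-2) (by simp)
  have h2 := hroot 2 (by simp)
  have h3 : ContinuousOn (fun c : ℝ => (Real.sqrt c : ℂ)) (Ioi 0) := by fun_prop
  refine (h3.mul (((h1.add h2).pow 2).div_const 4)).congr fun c _ => ?_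
  simp only [largeRoot, outerRoot_eq_sq, sub_eq_add_neg, Pi.mul_apply, Pi.add_apply, Pi.pow_apply]

theorem smallRoot_eq (hc : 0 < c) : smallRoot c z = z - largeRoot c z :=
  eq_sub_of_add_eq' (largeRoot_add_smallRoot hc)

/-- `σ = 2 w₊ - z` is a continuous square root of `z² - 4c`, so its difference quotient is `-4/(σ x
+ σ c)`; the hypothesis `hz` keeps `σ c` away from zero. -/
theorem hasDerivAt_largeRoot (hc : 0 < c) (hz : z ^ 2 ≠ 4 * c) :
    HasDerivAt (fun c : ℝ => largeRoot c z) (-1 / (largeRoot c z - smallRoot c z)) c := by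
  set σ : ℝ → ℂ := fun x => 2 * largeRoot x z - z with hσ
  have hcont : ContinuousAt σ c := by
    have := (continuousOn_largeRoot z).continuousAt (Ioi_mem_nhds hc)
    exact (continuousAt_const.mul this).sub continuousAt_const
  have hsq : ∀ x : ℝ, 0 < x → σ x ^ 2 = z ^ 2 - 4 * x := by
    intro x hx
    have h := largeRoot_mul_smallRoot hx (z := z)
    rw [smallRoot_eq hx] at h
    simp only [hσ]
    linear_combination -4 * h
  have hne : σ c ≠ 0 := by
    intro h
    have := hsq c hc
    rw [h] at this
    apply hz
    linear_combination -this
  have hd : HasDerivAt σ (-4 / (σ c + σ c)) c := by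
    rw [hasDerivAt_iff_tendsto_slope]
    have h2 : σ c + σ c ≠ 0 := by
      rw [← two_mul]; exact mul_ne_zero two_ne_zero hne
    have hlim : Filter.Tendsto (fun x => -4 / (σ x + σ c)) (nhdsWithin c {c}ᶜ)
        (nhds (-4 / (σ c + σ c))) := by
      refine Filter.Tendsto.mono_left ?_ nhdsWithin_le_nhds
      exact ContinuousAt.div continuousAt_const (hcont.add continuousAt_const) h2
    refine hlim.congr' ?_
    have hev : ∀ᶠ x in nhds c, 0 < x ∧ σ x + σ c ≠ 0 :=
      (lt_mem_nhds hc).and ((hcont.add continuousAt_const).eventually_ne h2)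
    filter_upwards [nhdsWithin_le_nhds hev, self_mem_nhdsWithin] with x hx hxc
    have hxc' : ((x : ℂ) - c) ≠ 0 := by
      rw [sub_ne_zero]; exact_mod_cast hxc
    rw [slope_def_module, Complex.real_smul, Complex.ofReal_inv, Complex.ofReal_sub,
      div_eq_iff hx.2]
    have := hsq x hx.1
    have := hsq c hc
    field_simp
    linear_combination hsq c hc - hsq x hx.1
  have h := (hd.add_const z).div_const 2
  have e : (fun x => (σ x + z) / 2) = fun x => largeRoot x z := by
    funext x; simp only [hσ]; ring
  rw [e] at h
  have e2 : σ c = largeRoot c z - smallRoot c z := by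
    rw [smallRoot_eq hc]; simp only [hσ]; ring
  have e3 : -1 / σ c = -4 / (σ c + σ c) / 2 := by
    field_simp
    norm_num
  rwa [← e2, e3]

end Roots

/-! ### The functional `f_t` as an integral over `(0, α)` -/

/-- The primitive in `α` of `log |largeRoot (t α) z|` that vanishes at `α = 0`. -/
def rootPrimitive (t : ℝ) (z : ℂ) (α : ℝ) : ℝ :=
  α * Real.log ‖largeRoot (t * α) z‖ + (smallRoot (t * α) z ^ 2).re / (2 * t)

theorem rootPrimitive_zero (t : ℝ) (z : ℂ) : rootPrimitive t z 0 = 0 := by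
  simp [rootPrimitive, smallRoot]

theorem heatFunctional_eq (g : ℝ → ℝ) {t α : ℝ} (ht : 0 < t) (hα : 0 ≤ α) (z : ℂ) :
    heatFunctional g t α z = g α + rootPrimitive t z α := by
  rcases hα.eq_or_lt with rfl | hα
  · simp [heatFunctional, rootPrimitive_zero]
  have hc : 0 < t * α := mul_pos ht hα
  have hsq : (Real.sqrt (t * α) : ℂ) ^ 2 = ((t * α : ℝ) : ℂ) := by
    rw [← Complex.ofReal_pow, Real.sq_sqrt hc.le]
  rw [heatFunctional, if_neg hα.ne', Psi_eq, rootPrimitive, norm_largeRoot, Real.log_mul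
    (Real.sqrt_pos.2 hc).ne' (zero_lt_one.trans_le (one_le_norm_outerRoot _)).ne', smallRoot,
    mul_pow, hsq, Complex.re_ofReal_mul]
  field_simp
  ring

theorem log_norm_largeRoot_bounds {t a : ℝ} (ht : 0 < t) (ha : 0 < a) (z : ℂ) :
    Real.log (t * a) / 2 ≤ Real.log ‖largeRoot (t * a) z‖ ∧
      Real.log ‖largeRoot (t * a) z‖ ≤ ‖z‖ + Real.sqrt (t * a) := by
  have hc : 0 < t * a := mul_pos ht ha
  refine ⟨?_, (Real.log_le_self (norm_nonneg _)).trans (norm_largeRoot_le hc)⟩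
  rw [← Real.log_sqrt hc.le]
  exact Real.log_le_log (Real.sqrt_pos.2 hc) (sqrt_le_norm_largeRoot _ _)

theorem continuousOn_log_norm_largeRoot {t : ℝ} (ht : 0 < t) (z : ℂ) :
    ContinuousOn (fun a => Real.log ‖largeRoot (t * a) z‖) (Ioi 0) := by
  refine ContinuousOn.log ?_ fun a ha => (norm_largeRoot_pos (mul_pos ht ha)).ne'
  exact ((continuousOn_largeRoot z).comp (by fun_prop) fun a ha => mul_pos ht ha).norm

theorem intervalIntegrable_log_norm_largeRoot {t α : ℝ} (ht : 0 < t) (hα : 0 ≤ α) (z : ℂ) :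
    IntervalIntegrable (fun a => Real.log ‖largeRoot (t * a) z‖) volume 0 α := by
  have hb : IntervalIntegrable
      (fun a => |Real.log t + Real.log a| / 2 + (‖z‖ + Real.sqrt (t * α))) volume 0 α := by
    refine IntervalIntegrable.add (IntervalIntegrable.div_const ?_ 2) (by simp)
    exact (IntervalIntegrable.add (by simp) intervalIntegral.intervalIntegrable_log').abs
  refine hb.mono_fun ?_ ?_
  · rw [uIoc_of_le hα]
    exact ((continuousOn_log_norm_largeRoot ht z).mono fun a ha => ha.1).aestronglyMeasurable
      measurableSet_Ioc
  · rw [uIoc_of_le hα]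
    refine (ae_restrict_iff' measurableSet_Ioc).2 (Filter.Eventually.of_forall fun a ha => ?_)
    obtain ⟨h1, h2⟩ := log_norm_largeRoot_bounds ht ha.1 z
    rw [Real.log_mul ht.ne' ha.1.ne'] at h1
    have h3 : Real.sqrt (t * a) ≤ Real.sqrt (t * α) :=
      Real.sqrt_le_sqrt (mul_le_mul_of_nonneg_left ha.2 ht.le)
    have h4 := neg_abs_le (Real.log t + Real.log a)
    have h5 := abs_nonneg (Real.log t + Real.log a)
    have h6 := norm_nonneg z
    have h7 := Real.sqrt_nonneg (t * α)
    simp only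
    rw [Real.norm_of_nonneg (by positivity : (0 : ℝ) ≤ |Real.log t + Real.log a| / 2 +
      (‖z‖ + Real.sqrt (t * α))), Real.norm_eq_abs, abs_le]
    constructor <;> linarith

/-- Only the endpoint `0` is delicate. There the bounds `√(ta) ≤ |w₊| ≤ |z| + √(ta)` and `|w₋|² ≤
ta` squeeze the function to zero. -/
theorem continuousOn_rootPrimitive {t : ℝ} (ht : 0 < t) (z : ℂ) :
    ContinuousOn (rootPrimitive t z) (Ici 0) := by
  have hL := continuousOn_largeRoot z
  have hmap : MapsTo (fun a : ℝ => t * a) (Ioi 0) (Ioi 0) := fun a ha => mul_pos ht ha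
  have hpos : ContinuousOn (rootPrimitive t z) (Ioi 0) := by
    have hs : ContinuousOn (fun a => smallRoot (t * a) z) (Ioi 0) :=
      (continuousOn_const.sub (hL.comp (by fun_prop) hmap)).congr fun a ha =>
        smallRoot_eq (mul_pos ht ha)
    refine (continuousOn_id.mul (continuousOn_log_norm_largeRoot ht z)).add
      (ContinuousOn.div_const ?_ _)
    exact Complex.continuous_re.comp_continuousOn (hs.pow 2)
  intro a ha
  rcases (mem_Ici.1 ha).eq_or_lt with h | h
  · subst h
    have hlow : ContinuousWithinAt (fun a => (2 * t)⁻¹ * ((t * a) * Real.log (t * a)) - a / 2)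
        (Ici 0) 0 := by
      have := Real.continuous_mul_log.comp (continuous_const_mul t)
      exact ((this.const_mul _).sub (continuous_id.div_const 2)).continuousWithinAt
    have hup : ContinuousWithinAt (fun a => a * (‖z‖ + Real.sqrt (t * a)) + a / 2)
        (Ici 0) 0 := by
      apply Continuous.continuousWithinAt
      fun_prop
    unfold ContinuousWithinAt at hlow hup ⊢
    rw [rootPrimitive_zero]
    simp only [mul_zero, Real.log_zero, zero_div, sub_zero, zero_mul, add_zero] at hlow hup
    refine tendsto_of_tendsto_of_tendsto_of_le_of_le' hlow hup ?_ ?_ <;>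
      filter_upwards [self_mem_nhdsWithin] with a ha <;>
      rcases (mem_Ici.1 ha).eq_or_lt with h | h <;>
      try (subst h; simp [rootPrimitive_zero])
    all_goals
      obtain ⟨h1, h2⟩ := log_norm_largeRoot_bounds ht h z
      have h3 : |(smallRoot (t * a) z ^ 2).re / (2 * t)| ≤ a / 2 := by
        rw [abs_div, abs_of_pos (by positivity : 0 < 2 * t), div_le_div_iff₀ (by positivity)
          two_pos]
        have h4 := (Complex.abs_re_le_norm (smallRoot (t * a) z ^ 2))
        rw [norm_pow] at h4
        have h5 := pow_le_pow_left₀ (norm_nonneg _) (norm_smallRoot_le_sqrt (t * a) z) 2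
        rw [Real.sq_sqrt (mul_pos ht h).le] at h5
        nlinarith
      have h6 := abs_le.1 h3
      unfold rootPrimitive
    · have h7 := mul_le_mul_of_nonneg_left h1 h.le
      have h8 : (2 * t)⁻¹ * (t * a * Real.log (t * a)) = a * (Real.log (t * a) / 2) := by
        field_simp
      linarith [h6.1]
    · have h7 := mul_le_mul_of_nonneg_left h2 h.le
      linarith [h6.2]
  · exact (hpos.continuousAt (Ioi_mem_nhds h)).continuousWithinAt

/-- Differentiating `log |w₊|` produces `-Re (w₋/(w₊ - w₋))` after multiplication by `a`, because
`w₊ w₋ = ta`; the term `Re w₋²/(2t)` is there to cancel it. -/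
theorem hasDerivAt_rootPrimitive {t a : ℝ} (ht : 0 < t) (ha : 0 < a) {z : ℂ}
    (hz : z ^ 2 ≠ 4 * (t * a : ℝ)) :
    HasDerivAt (rootPrimitive t z) (Real.log ‖largeRoot (t * a) z‖) a := by
  have hc : 0 < t * a := mul_pos ht ha
  have hmul : HasDerivAt (fun x : ℝ => t * x) t a := by
    simpa using (hasDerivAt_id a).const_mul t
  set w := largeRoot (t * a) z with hw
  set v := smallRoot (t * a) z with hv
  have hwv : w * v = ((t * a : ℝ) : ℂ) := largeRoot_mul_smallRoot hc
  have hsum : w + v = z := largeRoot_add_smallRoot hc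
  have hne : w - v ≠ 0 := by
    intro h
    apply hz
    rw [← hwv, ← hsum]
    linear_combination (w - v) * h
  have hw0 : w ≠ 0 := norm_pos_iff.1 (norm_largeRoot_pos hc)
  have hdw : HasDerivAt (fun x : ℝ => largeRoot (t * x) z) (-(t : ℂ) / (w - v)) a := by
    refine ((hasDerivAt_largeRoot hc hz).scomp a hmul).congr_deriv ?_
    rw [Complex.real_smul]
    ring
  have hdv : HasDerivAt (fun x : ℝ => smallRoot (t * x) z) ((t : ℂ) / (w - v)) a := by
    have := hdw.const_sub z
    rw [neg_div, neg_neg] at this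
    refine this.congr_of_eventuallyEq ?_
    filter_upwards [lt_mem_nhds ha] with x hx
    exact smallRoot_eq (mul_pos ht hx)
  have hnorm : HasDerivAt (fun x : ℝ => Real.log ‖largeRoot (t * x) z‖)
      ((-(t : ℂ) / (w - v) / w).re) a := by
    have h1 := (hdw.norm_sq.log (by positivity)).div_const 2
    have h2 : (fun x : ℝ => Real.log (‖largeRoot (t * x) z‖ ^ 2) / 2) =
        fun x : ℝ => Real.log ‖largeRoot (t * x) z‖ := by
      funext x
      rw [Real.log_pow]
      push_cast
      ring
    rw [h2] at h1
    refine h1.congr_deriv ?_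
    rw [Complex.inner, ← hw, ← Complex.normSq_eq_norm_sq, Complex.div_re (-(t : ℂ) / (w - v)) w]
    simp only [Complex.mul_re, Complex.conj_re, Complex.conj_im]
    ring
  have hsq : HasDerivAt (fun x : ℝ => (smallRoot (t * x) z ^ 2).re / (2 * t))
      ((2 * v * ((t : ℂ) / (w - v))).re / (2 * t)) a := by
    have h1 := hdv.pow 2
    refine ((Complex.reCLM.hasFDerivAt.comp_hasDerivAt a h1).div_const (2 * t)).congr_deriv ?_
    simp [hv]
  refine (((hasDerivAt_id a).mul hnorm).add hsq).congr_deriv ?_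
  have e1 : a * ((-(t : ℂ) / (w - v) / w).re) = -(v / (w - v)).re := by
    rw [← Complex.re_ofReal_mul, ← Complex.neg_re]
    congr 1
    have hav : (a : ℂ) * t = w * v := by rw [hwv]; push_cast; ring
    field_simp
    linear_combination -hav
  have e2 : (2 * v * ((t : ℂ) / (w - v))).re / (2 * t) = (v / (w - v)).re := by
    have : 2 * v * ((t : ℂ) / (w - v)) = ((2 * t : ℝ) : ℂ) * (v / (w - v)) := by
      push_cast; ring
    rw [this, Complex.re_ofReal_mul]
    field_simp
  rw [e2]
  simp only [id, e1]
  ring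

/-- The fundamental theorem of calculus, with the at most one branch point `z² = 4ta` as exceptional
set. -/
theorem integral_log_norm_largeRoot {t α : ℝ} (ht : 0 < t) (hα : 0 ≤ α) (z : ℂ) :
    ∫ a in (0 : ℝ)..α, Real.log ‖largeRoot (t * a) z‖ = rootPrimitive t z α := by
  have hs : {a : ℝ | z ^ 2 = 4 * (t * a : ℝ)}.Countable := by
    refine Set.Subsingleton.countable fun a ha b hb => ?_
    have h : (4 : ℂ) * (t * a : ℝ) = 4 * (t * b : ℝ) := by
      rw [mem_ofPred_eq] at ha hb
      rw [← ha, ← hb]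
    have h2 : t * a = t * b := by exact_mod_cast mul_left_cancel₀ (by norm_num : (4 : ℂ) ≠ 0) h
    exact mul_left_cancel₀ ht.ne' h2
  rw [integral_eq_of_hasDerivAt_off_countable_of_le (rootPrimitive t z) _ hα hs
    ((continuousOn_rootPrimitive ht z).mono fun a ha => ha.1)
    (fun a ha => hasDerivAt_rootPrimitive ht ha.1.1 ha.2)
    (intervalIntegrable_log_norm_largeRoot ht hα z), rootPrimitive_zero, sub_zero]

/-! ### Suprema as integrals of positive parts -/

/-- For a decreasing function the supremum of the primitive is the integral of the positive
part. -/
theorem sSup_integral_of_antitoneOn {h : ℝ → ℝ} (hanti : AntitoneOn h (Ioc 0 1))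
    (hint : IntervalIntegrable h volume 0 1) :
    sSup ((fun α : ℝ => ∫ a in (0 : ℝ)..α, h a) '' Icc 0 1) = ∫ a in (0 : ℝ)..1, max (h a) 0 := by
  have hpos : IntervalIntegrable (fun a => max (h a) 0) volume 0 1 := by
    rw [intervalIntegrable_iff] at hint ⊢
    exact hint.pos_part
  have hsub : ∀ {f : ℝ → ℝ} {a b : ℝ}, IntervalIntegrable f volume 0 1 → a ∈ Icc (0 : ℝ) 1 →
      b ∈ Icc (0 : ℝ) 1 → IntervalIntegrable f volume a b := fun hf ha hb =>
    hf.mono_set (by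
      rw [uIcc_of_le zero_le_one]
      exact uIcc_subset_Icc ha hb)
  have h0 : (0 : ℝ) ∈ Icc (0 : ℝ) 1 := ⟨le_rfl, zero_le_one⟩
  have h1 : (1 : ℝ) ∈ Icc (0 : ℝ) 1 := ⟨zero_le_one, le_rfl⟩
  have hub : ∀ α ∈ Icc (0 : ℝ) 1, ∫ a in (0 : ℝ)..α, h a ≤ ∫ a in (0 : ℝ)..1, max (h a) 0 := by
    intro α hα
    rw [← intervalIntegral.integral_add_adjacent_intervals (hsub hpos h0 hα) (hsub hpos hα h1)]
    have e1 : ∫ a in (0 : ℝ)..α, h a ≤ ∫ a in (0 : ℝ)..α, max (h a) 0 :=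
      intervalIntegral.integral_mono_on hα.1 (hsub hint h0 hα) (hsub hpos h0 hα)
        fun a _ => le_max_left _ _
    have e2 : 0 ≤ ∫ a in α..1, max (h a) 0 :=
      intervalIntegral.integral_nonneg hα.2 fun a _ => le_max_right _ _
    linarith
  -- The supremum of `S` is the point where `h` changes sign; inserting `0` keeps `S` nonempty when
  -- `h` is negative throughout.
  set S : Set ℝ := insert 0 {a ∈ Ioc (0 : ℝ) 1 | 0 ≤ h a} with hS
  have hS1 : ∀ a ∈ S, a ∈ Icc (0 : ℝ) 1 := by
    rintro a (rfl | ha)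
    · exact h0
    · exact Ioc_subset_Icc_self ha.1
  have hbdd : BddAbove S := ⟨1, fun a ha => (hS1 a ha).2⟩
  set c := sSup S with hc
  have hc01 : c ∈ Icc (0 : ℝ) 1 :=
    ⟨le_csSup hbdd (mem_insert _ _), csSup_le ⟨0, mem_insert _ _⟩ fun a ha => (hS1 a ha).2⟩
  have hleft : ∀ a ∈ Ioo 0 c, 0 ≤ h a := by
    intro a ha
    obtain ⟨b, hb, hab⟩ := exists_lt_of_lt_csSup ⟨0, mem_insert _ _⟩ ha.2
    rcases hb with rfl | hb
    · exact absurd ha.1 (not_lt.2 hab.le)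
    · exact hb.2.trans (hanti ⟨ha.1, ha.2.le.trans hc01.2⟩ hb.1 hab.le)
  have hright : ∀ a ∈ Ioc c 1, h a ≤ 0 := by
    intro a ha
    by_contra hn
    exact not_lt.2 (le_csSup hbdd (Or.inr ⟨⟨hc01.1.trans_lt ha.1, ha.2⟩, (not_le.1 hn).le⟩)) ha.1
  have hval : ∫ a in (0 : ℝ)..c, h a = ∫ a in (0 : ℝ)..1, max (h a) 0 := by
    rw [← intervalIntegral.integral_add_adjacent_intervals (hsub hpos h0 hc01) (hsub hpos hc01 h1)]
    have e1 : ∫ a in (0 : ℝ)..c, max (h a) 0 = ∫ a in (0 : ℝ)..c, h a := by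
      rw [intervalIntegral.integral_of_le hc01.1, intervalIntegral.integral_of_le hc01.1,
        integral_Ioc_eq_integral_Ioo, integral_Ioc_eq_integral_Ioo]
      exact setIntegral_congr_fun measurableSet_Ioo fun a ha => max_eq_left (hleft a ha)
    have e2 : ∫ a in c..1, max (h a) 0 = 0 := by
      rw [intervalIntegral.integral_of_le hc01.2]
      exact setIntegral_eq_zero_of_forall_eq_zero fun a ha => max_eq_right (hright a ha)
    rw [e1, e2, add_zero]
  refine IsLUB.csSup_eq ⟨?_, fun x hx => ?_⟩ ⟨_, mem_image_of_mem _ h0⟩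
  · rintro _ ⟨α, hα, rfl⟩
    exact hub α hα
  · rw [← hval]
    exact hx ⟨c, hc01, rfl⟩

/-- The profile is the primitive of `-β log a`, so it merges with `L`. Subtracting its value at `1`
adds `β log a` back under the integral of the positive part. -/
theorem sSup_profile_add_integral {β : ℝ} {L : ℝ → ℝ}
    (hint : IntervalIntegrable L volume 0 1)
    (hanti : AntitoneOn (fun a => L a - β * Real.log a) (Ioc 0 1)) :
    sSup ((fun α : ℝ => littlewoodOffordProfile β α + ∫ a in (0 : ℝ)..α, L a) '' Icc 0 1)
      - littlewoodOffordProfile β 1 = ∫ a in (0 : ℝ)..1, max (β * Real.log a) (L a) := by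
  have hlog : ∀ α : ℝ, IntervalIntegrable (fun a => β * Real.log a) volume 0 α := fun α =>
    intervalIntegral.intervalIntegrable_log'.const_mul β
  have hh : IntervalIntegrable (fun a => L a - β * Real.log a) volume 0 1 := hint.sub (hlog 1)
  have e1 : ∀ α ∈ Icc (0 : ℝ) 1, littlewoodOffordProfile β α + ∫ a in (0 : ℝ)..α, L a =
      ∫ a in (0 : ℝ)..α, (L a - β * Real.log a) := by
    intro α hα
    have hL : IntervalIntegrable L volume 0 α := hint.mono_set (by
      rw [uIcc_of_le zero_le_one, uIcc_of_le hα.1]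
      exact Icc_subset_Icc le_rfl hα.2)
    rw [intervalIntegral.integral_sub hL (hlog α), intervalIntegral.integral_const_mul,
      integral_log, littlewoodOffordProfile]
    ring
  rw [image_congr e1, sSup_integral_of_antitoneOn hanti hh]
  have hpos : IntervalIntegrable (fun a => max (L a - β * Real.log a) 0) volume 0 1 := by
    rw [intervalIntegrable_iff] at hh ⊢
    exact hh.pos_part
  have e2 : ∫ a in (0 : ℝ)..1, max (β * Real.log a) (L a) =
      ∫ a in (0 : ℝ)..1, (max (L a - β * Real.log a) 0 + β * Real.log a) := by
    congr 1
    funext a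
    rw [← max_add_add_right, sub_add_cancel, zero_add, max_comm]
  rw [e2, intervalIntegral.integral_add hpos (hlog 1), intervalIntegral.integral_const_mul,
    integral_log, littlewoodOffordProfile]
  simp [sub_eq_add_neg]

theorem initialPotential_eq {β : ℝ} (hβ : 0 < β) (z : ℂ) :
    initialPotential (littlewoodOffordProfile β) z =
      ∫ a in (0 : ℝ)..1, max (β * Real.log a) (Real.log ‖z‖) := by
  rw [← sSup_profile_add_integral (L := fun _ => Real.log ‖z‖) (by simp)]
  · simp [initialPotential]
  · intro a ha b hb hab
    have := mul_le_mul_of_nonneg_left (Real.log_le_log ha.1 hab) hβ.le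
    simp only
    linarith

/-- Monotonicity comes from writing `log |w₊| - β log a` as `log |w₊| - ½ log(ta)`, which decreases,
plus a constant minus `(β - ½) log a`. Here `β > 1/2` is essential. -/
theorem heatPotential_eq {β t : ℝ} (hβ : 1 / 2 < β) (ht : 0 < t) (z : ℂ) :
    heatPotential (littlewoodOffordProfile β) t z =
      ∫ a in (0 : ℝ)..1, max (β * Real.log a) (Real.log ‖largeRoot (t * a) z‖) := by
  rw [← sSup_profile_add_integral (intervalIntegrable_log_norm_largeRoot ht zero_le_one z),
    heatPotential]
  · congr 2
    refine image_congr fun α hα => ?_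
    rw [heatFunctional_eq _ ht hα.1, integral_log_norm_largeRoot ht hα.1]
  · intro a ha b hb hab
    have h1 := log_norm_largeRoot_sub_anti (z := z) (mul_pos ht ha.1)
      (mul_le_mul_of_nonneg_left hab ht.le)
    rw [Real.log_mul ht.ne' ha.1.ne', Real.log_mul ht.ne' hb.1.ne'] at h1
    have h2 := mul_le_mul_of_nonneg_left (Real.log_le_log ha.1 hab)
      (by linarith : 0 ≤ β - 1 / 2)
    simp only
    linarith

/-! ### Potentials of images of a product measure -/

/-- The uniform probability measure on the angles `(-π, π)`. -/
def angleMeasure : Measure ℝ :=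
  ENNReal.ofReal (2 * Real.pi)⁻¹ • volume.restrict (Ioo (-Real.pi) Real.pi)

/-- The uniform probability measure on `(0, 1) × (-π, π)`. -/
def baseMeasure : Measure (ℝ × ℝ) := (volume.restrict (Ioo 0 1)).prod angleMeasure

instance : IsProbabilityMeasure angleMeasure := by
  constructor
  rw [angleMeasure, Measure.smul_apply, Measure.restrict_apply_univ, Real.volume_Ioo, smul_eq_mul,
    ← ENNReal.ofReal_mul (by positivity), ← ENNReal.ofReal_one]
  congr 1
  have := Real.pi_pos
  field_simp
  ring

instance : IsProbabilityMeasure (volume.restrict (Ioo (0 : ℝ) 1)) := by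
  constructor
  rw [Measure.restrict_apply_univ, Real.volume_Ioo]
  simp

instance : IsProbabilityMeasure baseMeasure := by
  unfold baseMeasure
  infer_instance

theorem integral_angleMeasure (f : ℝ → ℝ) :
    ∫ θ, f θ ∂angleMeasure = (2 * Real.pi)⁻¹ * ∫ θ in Ioo (-Real.pi) Real.pi, f θ := by
  rw [angleMeasure, integral_smul_measure, ENNReal.toReal_ofReal (by positivity), smul_eq_mul]

theorem integrable_angleMeasure_log_norm_sub (c a : ℂ) (r : ℝ) :
    Integrable (fun θ => Real.log ‖circleMap c r θ - a‖) angleMeasure :=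
  Integrable.smul_measure (circleIntegrable_log_norm_sub_on_Ioo c a r) ENNReal.ofReal_ne_top

theorem integral_angleMeasure_log_norm_sub {r : ℝ} (hr : 0 < r) {a : ℂ} (ha : a ≠ 0) :
    ∫ θ, Real.log ‖circleMap 0 r θ - a‖ ∂angleMeasure = max (Real.log r) (Real.log ‖a‖) := by
  rw [integral_angleMeasure,
    ← circleAverage_eq_setIntegral (fun z => Real.log ‖z - a‖), circleAverage_log_norm_sub hr ha,
    zero_sub, norm_neg]

theorem angleMeasure_ae_ne {r : ℝ} (hr : r ≠ 0) (a : ℂ) :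
    ∀ᵐ θ ∂angleMeasure, circleMap 0 r θ ≠ a := by
  have h : ∀ᵐ θ : ℝ, circleMap 0 r θ ≠ a := by
    rw [ae_iff]
    simp only [ne_eq, not_not]
    exact ((countable_singleton a).preimage_circleMap 0 hr).measure_zero volume
  exact (Measure.ae_smul_measure (ae_restrict_of_ae h) _)

/-- Factor `z - (w + c/w) = -(w - w₊)(w - w₋)/w`. The angles where `w` hits a root are discarded,
since there `Real.log 0 = 0` breaks the product rule. -/
theorem log_norm_sub_joukowski {ρ c : ℝ} (hc : 0 < c) (hρ : 0 < ρ) (z : ℂ) :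
    ∀ᵐ θ ∂angleMeasure,
      Real.log ‖z - (circleMap 0 ρ θ + c / circleMap 0 ρ θ)‖ =
        Real.log ‖circleMap 0 ρ θ - largeRoot c z‖ +
          Real.log ‖circleMap 0 ρ θ - smallRoot c z‖ - Real.log ρ := by
  filter_upwards [angleMeasure_ae_ne hρ.ne' (largeRoot c z),
    angleMeasure_ae_ne hρ.ne' (smallRoot c z)] with θ h1 h2
  set w := circleMap 0 ρ θ with hw
  have hwn : ‖w‖ = ρ := by rw [hw, norm_circleMap_zero, abs_of_pos hρ]
  have hw0 : w ≠ 0 := norm_pos_iff.1 (by rw [hwn]; exact hρ)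
  have e : z - (w + c / w) = -((w - largeRoot c z) * (w - smallRoot c z)) / w := by
    field_simp
    linear_combination -w * largeRoot_add_smallRoot hc (z := z) +
      largeRoot_mul_smallRoot hc (z := z)
  rw [e, norm_div, norm_neg, norm_mul, hwn,
    Real.log_div (mul_ne_zero (norm_ne_zero_iff.2 (sub_ne_zero.2 h1))
      (norm_ne_zero_iff.2 (sub_ne_zero.2 h2))) hρ.ne',
    Real.log_mul (norm_ne_zero_iff.2 (sub_ne_zero.2 h1)) (norm_ne_zero_iff.2 (sub_ne_zero.2 h2))]

theorem integrable_log_norm_sub_joukowski {ρ c : ℝ} (hc : 0 < c) (hρ : 0 < ρ) (z : ℂ) :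
    Integrable (fun θ => Real.log ‖z - (circleMap 0 ρ θ + c / circleMap 0 ρ θ)‖)
      angleMeasure := by
  refine (((integrable_angleMeasure_log_norm_sub 0 (largeRoot c z) ρ).add
    (integrable_angleMeasure_log_norm_sub 0 (smallRoot c z) ρ)).sub
      (integrable_const (Real.log ρ))).congr ?_
  filter_upwards [log_norm_sub_joukowski hc hρ z] with θ h
  rw [h]
  rfl

/-- Jensen's formula for each root. As `|w₋| ≤ √c ≤ ρ`, the small root contributes `log ρ`, which
cancels the `-log ρ` of the denominator. -/
theorem integral_log_norm_sub_joukowski {ρ c : ℝ} (hc : 0 < c) (hρ : Real.sqrt c ≤ ρ) (z : ℂ) :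
    ∫ θ, Real.log ‖z - (circleMap 0 ρ θ + c / circleMap 0 ρ θ)‖ ∂angleMeasure =
      max (Real.log ρ) (Real.log ‖largeRoot c z‖) := by
  have hρ0 : 0 < ρ := (Real.sqrt_pos.2 hc).trans_le hρ
  have hne : largeRoot c z * smallRoot c z ≠ 0 := by
    rw [largeRoot_mul_smallRoot hc]
    exact_mod_cast hc.ne'
  have h1 := integrable_angleMeasure_log_norm_sub 0 (largeRoot c z) ρ
  have h2 := integrable_angleMeasure_log_norm_sub 0 (smallRoot c z) ρ
  have h12 : Integrable (fun θ => Real.log ‖circleMap 0 ρ θ - largeRoot c z‖ +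
      Real.log ‖circleMap 0 ρ θ - smallRoot c z‖) angleMeasure := h1.add h2
  rw [integral_congr_ae (log_norm_sub_joukowski hc hρ0 z), integral_sub h12
    (integrable_const _), integral_add h1 h2,
    integral_angleMeasure_log_norm_sub hρ0 (left_ne_zero_of_mul hne),
    integral_angleMeasure_log_norm_sub hρ0 (right_ne_zero_of_mul hne),
    max_eq_left (Real.log_le_log (norm_pos_iff.2 (right_ne_zero_of_mul hne))
      ((norm_smallRoot_le_sqrt c z).trans hρ))]
  simp

/-- Integration in the angle first computes the logarithmic potential of the image of the base
measure. -/
theorem hasLogPotentialAt_map_baseMeasure {β R : ℝ} {Φ : ℝ × ℝ → ℂ} (hΦ : Measurable Φ)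
    (hR : ∀ a ∈ Ioo (0 : ℝ) 1, ∀ θ, ‖Φ (a, θ)‖ ≤ R) {z : ℂ} {L : ℝ → ℝ}
    (hL : IntervalIntegrable L volume 0 1)
    (hint : ∀ a ∈ Ioo (0 : ℝ) 1, Integrable (fun θ => Real.log ‖z - Φ (a, θ)‖) angleMeasure)
    (hval : ∀ a ∈ Ioo (0 : ℝ) 1,
      ∫ θ, Real.log ‖z - Φ (a, θ)‖ ∂angleMeasure = max (β * Real.log a) (L a)) :
    HasLogPotentialAt (baseMeasure.map Φ) z
      (∫ a in (0 : ℝ)..1, max (β * Real.log a) (L a)) := by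
  have hlog : IntervalIntegrable (fun a => β * Real.log a) volume 0 1 :=
    intervalIntegral.intervalIntegrable_log'.const_mul β
  have hmax : Integrable (fun a => max (β * Real.log a) (L a)) (volume.restrict (Ioo 0 1)) := by
    rw [intervalIntegrable_iff_integrableOn_Ioo_of_le zero_le_one] at hL hlog
    exact hlog.sup hL
  have hmem : ∀ᵐ a ∂(volume.restrict (Ioo (0 : ℝ) 1)), a ∈ Ioo (0 : ℝ) 1 :=
    ae_restrict_mem measurableSet_Ioo
  have hprod : Integrable (fun p => Real.log ‖z - Φ p‖) baseMeasure := by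
    refine integrable_prod_of_le (C := ‖z‖ + R) ?_ ?_ ?_ ?_
    · apply Measurable.aestronglyMeasurable
      fun_prop
    · filter_upwards [hmem] with a ha θ
      exact (Real.log_le_self (norm_nonneg _)).trans ((norm_sub_le _ _).trans
        (by gcongr; exact hR a ha θ))
    · filter_upwards [hmem] with a ha using hint a ha
    · refine hmax.congr ?_
      filter_upwards [hmem] with a ha using (hval a ha).symm
  have hm : AEStronglyMeasurable (fun y : ℂ => Real.log ‖z - y‖) (baseMeasure.map Φ) := by
    apply Measurable.aestronglyMeasurable
    fun_prop
  refine ⟨(integrable_map_measure hm hΦ.aemeasurable).2 hprod, ?_⟩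
  rw [integral_map hΦ.aemeasurable hm, baseMeasure, integral_prod _ hprod,
    intervalIntegral.integral_of_le zero_le_one, integral_Ioc_eq_integral_Ioo]
  exact setIntegral_congr_fun measurableSet_Ioo fun a ha => hval a ha

theorem map_baseMeasure_compl_closedBall {R : ℝ} {Φ : ℝ × ℝ → ℂ} (hΦ : Measurable Φ)
    (hR : ∀ a ∈ Ioo (0 : ℝ) 1, ∀ θ, ‖Φ (a, θ)‖ ≤ R) :
    ∃ K : Set ℂ, IsCompact K ∧ baseMeasure.map Φ Kᶜ = 0 := by
  refine ⟨Metric.closedBall 0 R, isCompact_closedBall 0 R, ?_⟩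
  have h : ∀ᵐ y ∂(baseMeasure.map Φ), y ∈ Metric.closedBall (0 : ℂ) R := by
    rw [ae_map_iff (p := fun y => y ∈ Metric.closedBall (0 : ℂ) R) hΦ.aemeasurable
      Metric.isClosed_closedBall.measurableSet, baseMeasure]
    have h1 : ∀ᵐ p ∂((volume.restrict (Ioo (0 : ℝ) 1)).prod angleMeasure), p.1 ∈ Ioo (0 : ℝ) 1 :=
      Measure.quasiMeasurePreserving_fst.ae (ae_restrict_mem measurableSet_Ioo)
    filter_upwards [h1] with p hp
    simpa using hR p.1 hp p.2
  exact h

/-! ### The measure `ν₀` -/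

/-- The point with radius `α ^ β` and angle `θ`. -/
def polarPoint (β : ℝ) (p : ℝ × ℝ) : ℂ := circleMap 0 (p.1 ^ β) p.2

theorem measurable_polarPoint (β : ℝ) : Measurable (polarPoint β) := by
  unfold polarPoint circleMap
  fun_prop

theorem norm_polarPoint (β : ℝ) {a : ℝ} (ha : 0 < a) (θ : ℝ) : ‖polarPoint β (a, θ)‖ = a ^ β := by
  rw [polarPoint, norm_circleMap_zero, abs_of_pos (Real.rpow_pos_of_pos ha β)]

theorem norm_polarPoint_le {β : ℝ} (hβ : 0 < β) {a : ℝ} (ha : a ∈ Ioo (0 : ℝ) 1) (θ : ℝ) :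
    ‖polarPoint β (a, θ)‖ ≤ 1 := by
  rw [norm_polarPoint β ha.1]
  exact Real.rpow_le_one ha.1.le ha.2.le hβ.le

/-- The measure `ν₀`. -/
def initialMeasure (β : ℝ) : Measure ℂ := baseMeasure.map (polarPoint β)

instance (β : ℝ) : IsProbabilityMeasure (initialMeasure β) :=
  Measure.isProbabilityMeasure_map (measurable_polarPoint β).aemeasurable

theorem hasLogPotentialAt_initialMeasure {β : ℝ} (hβ : 0 < β) {z : ℂ} (hz : z ≠ 0) :
    HasLogPotentialAt (initialMeasure β) z (initialPotential (littlewoodOffordProfile β) z) := by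
  rw [initialPotential_eq hβ]
  refine hasLogPotentialAt_map_baseMeasure (measurable_polarPoint β)
    (fun a ha θ => norm_polarPoint_le hβ ha θ) (by simp) (fun a ha => ?_) fun a ha => ?_ <;>
    simp_rw [norm_sub_rev z, polarPoint]
  · exact integrable_angleMeasure_log_norm_sub _ _ _
  · rw [integral_angleMeasure_log_norm_sub (Real.rpow_pos_of_pos ha.1 β) hz, Real.log_rpow ha.1]

theorem isInitialMeasure_initialMeasure {β : ℝ} (hβ : 0 < β) :
    IsInitialMeasure (littlewoodOffordProfile β) (initialMeasure β) := by
  have hsupp := map_baseMeasure_compl_closedBall (measurable_polarPoint β)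
    (fun a ha θ => norm_polarPoint_le hβ ha θ)
  refine ⟨inferInstance, hsupp, fun c hc => ?_,
    fun z hz => hasLogPotentialAt_initialMeasure hβ hz⟩
  have hm : Measurable fun w : ℂ => c * w := measurable_const_mul c
  have hc0 : c ≠ 0 := norm_pos_iff.1 (by rw [hc]; exact one_pos)
  have e : (initialMeasure β).map (fun w => c * w) =
      baseMeasure.map (fun p => c * polarPoint β p) :=
    Measure.map_map hm (measurable_polarPoint β)
  have : IsProbabilityMeasure ((initialMeasure β).map fun w => c * w) :=
    Measure.isProbabilityMeasure_map hm.aemeasurable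
  -- Rotation invariance follows from uniqueness: the rotated measure has the same radial potential.
  refine measure_ext_of_logPotential ?_ hsupp (fun z hz => ?_)
    (fun z hz => hasLogPotentialAt_initialMeasure hβ hz)
  · rw [e]
    refine map_baseMeasure_compl_closedBall (R := 1) (hm.comp (measurable_polarPoint β))
      fun a ha θ => ?_
    rw [norm_mul, hc, one_mul]
    exact norm_polarPoint_le hβ ha θ
  · have h := hasLogPotentialAt_initialMeasure hβ (mul_ne_zero (inv_ne_zero hc0) hz)
    have hn : initialPotential (littlewoodOffordProfile β) (c⁻¹ * z) =
        initialPotential (littlewoodOffordProfile β) z := by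
      simp [initialPotential, hc]
    rw [hn] at h
    have hf : ∀ w : ℂ, Real.log ‖c⁻¹ * z - w‖ = Real.log ‖z - c * w‖ := by
      intro w
      have : z - c * w = c * (c⁻¹ * z - w) := by field_simp
      rw [this, norm_mul, hc, one_mul]
    have hm2 : AEStronglyMeasurable (fun y : ℂ => Real.log ‖z - y‖)
        ((initialMeasure β).map fun w => c * w) := by
      apply Measurable.aestronglyMeasurable
      fun_prop
    simp only [HasLogPotentialAt, hf] at h
    exact ⟨(integrable_map_measure hm2 hm.aemeasurable).2 h.1,
      (integral_map hm.aemeasurable hm2).trans h.2⟩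

theorem initialMeasure_closedBall {β r : ℝ} (hβ : 0 < β) (hr : r ∈ Ioo (0 : ℝ) 1) :
    initialMeasure β {z : ℂ | ‖z‖ ≤ r} = ENNReal.ofReal (r ^ (1 / β)) := by
  have hs : MeasurableSet {z : ℂ | ‖z‖ ≤ r} := measurableSet_le measurable_norm measurable_const
  have hr0 := Real.rpow_nonneg hr.1.le (1 / β)
  have hr1 : r ^ (1 / β) < 1 := Real.rpow_lt_one hr.1.le hr.2 (by positivity)
  have h1 : initialMeasure β {z : ℂ | ‖z‖ ≤ r} =
      baseMeasure (Iic (r ^ (1 / β)) ×ˢ univ) := by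
    rw [initialMeasure, Measure.map_apply (measurable_polarPoint β) hs]
    apply measure_congr
    have hmem : ∀ᵐ p ∂baseMeasure, p.1 ∈ Ioo (0 : ℝ) 1 :=
      Measure.quasiMeasurePreserving_fst.ae (ae_restrict_mem measurableSet_Ioo)
    filter_upwards [hmem] with p hp
    apply propext
    change ‖polarPoint β (p.1, p.2)‖ ≤ r ↔ p ∈ Iic (r ^ (1 / β)) ×ˢ univ
    rw [norm_polarPoint β hp.1, mem_prod, one_div, mem_Iic,
      Real.le_rpow_inv_iff_of_pos hp.1.le hr.1.le hβ]
    simp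
  rw [h1, baseMeasure, Measure.prod_prod, measure_univ, mul_one,
    Measure.restrict_apply measurableSet_Iic]
  have h2 : Iic (r ^ (1 / β)) ∩ Ioo 0 1 = Ioc 0 (r ^ (1 / β)) := by
    ext x
    simp only [mem_inter_iff, mem_Iic, mem_Ioo, mem_Ioc]
    constructor
    · rintro ⟨h, h', _⟩; exact ⟨h', h⟩
    · rintro ⟨h, h'⟩; exact ⟨h', h, h'.trans_lt hr1⟩
  rw [h2, Real.volume_Ioc, sub_zero]

/-! ### The push-forward has potential `U_t` -/

theorem measurable_transportMap (β t : ℝ) : Measurable (transportMap β t) := by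
  unfold transportMap
  fun_prop

theorem measurable_modifiedTransportMap (β t : ℝ) : Measurable (modifiedTransportMap β t) := by
  unfold modifiedTransportMap
  refine Measurable.ite (measurableSet_lt measurable_norm measurable_const) (by fun_prop)
    (Measurable.ite (measurableSet_le measurable_norm measurable_const)
      (measurable_transportMap β t) (by fun_prop))

theorem collapseRadius_pos (β : ℝ) {t : ℝ} (ht : 0 < t) : 0 < collapseRadius β t :=
  Real.rpow_pos_of_pos ht _

/-- The logarithmic form of `a^β < √(ta)`: collapse occurs exactly where `a^β` drops below the
critical Joukowski radius. -/
theorem rpow_lt_collapseRadius_iff {β t a : ℝ} (hβ : 1 / 2 < β) (ht : 0 < t) (ha : 0 < a) :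
    a ^ β < collapseRadius β t ↔ (2 * β - 1) * Real.log a < Real.log t := by
  have h2 : 0 < 2 * β - 1 := by linarith
  have hβ0 : 0 < β := by linarith
  rw [← Real.log_lt_log_iff (Real.rpow_pos_of_pos ha β) (collapseRadius_pos β ht),
    collapseRadius, Real.log_rpow ha, Real.log_rpow ht, div_mul_eq_mul_div, lt_div_iff₀ h2]
  constructor <;> intro h
  · nlinarith
  · nlinarith

theorem modifiedTransportMap_polarPoint_of_lt {β t a : ℝ} (hβ : 1 / 2 < β) (ht : 0 < t)
    (ha : 0 < a) (h : a ^ β < collapseRadius β t) (θ : ℝ) :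
    modifiedTransportMap β t (polarPoint β (a, θ)) =
      ((2 * Real.sqrt (t * a) * Real.cos θ : ℝ) : ℂ) := by
  have hβ0 : β ≠ 0 := by linarith
  have hn := norm_polarPoint β ha θ
  rw [modifiedTransportMap, if_pos (by rwa [hn]), hn]
  congr 1
  have hre : (polarPoint β (a, θ)).re = a ^ β * Real.cos θ := by
    rw [polarPoint, circleMap_zero_re]
  have he : a ^ β * (a ^ β) ^ ((1 - 2 * β) / (2 * β)) = Real.sqrt a := by
    rw [← Real.rpow_mul ha.le, ← Real.rpow_add ha, Real.sqrt_eq_rpow]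
    congr 1
    field_simp
    ring
  rw [hre, Real.sqrt_mul ht.le, ← he]
  ring

theorem circleMap_add_mul_div {X : ℝ} (Y θ : ℝ) (hX : X ≠ 0) :
    circleMap 0 X θ + ((X * Y : ℝ) : ℂ) / circleMap 0 X θ =
      (((X + Y) * Real.cos θ : ℝ) : ℂ) + (((X - Y) * Real.sin θ : ℝ) : ℂ) * Complex.I := by
  have h : (X : ℂ) ≠ 0 := by exact_mod_cast hX
  have h2 : (circleMap 0 X θ)⁻¹ = (X : ℂ)⁻¹ * (Complex.cos θ - Complex.sin θ * Complex.I) := by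
    rw [circleMap_zero, mul_inv, ← Complex.exp_neg, ← neg_mul, Complex.exp_mul_I, Complex.cos_neg,
      Complex.sin_neg, neg_mul, sub_eq_add_neg]
  rw [div_eq_mul_inv, h2, circleMap_zero, Complex.exp_mul_I]
  push_cast
  field_simp
  ring

theorem circleMap_add_sq_div {s : ℝ} (θ : ℝ) (hs : s ≠ 0) :
    circleMap 0 s θ + ((s ^ 2 : ℝ) : ℂ) / circleMap 0 s θ = ((2 * s * Real.cos θ : ℝ) : ℂ) := by
  rw [pow_two, circleMap_add_mul_div s θ hs, sub_self, zero_mul, Complex.ofReal_zero, zero_mul,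
    add_zero, two_mul]

theorem modifiedTransportMap_polarPoint_of_ge {β t a : ℝ} (hβ : 1 / 2 < β)
    (ha : a ∈ Ioo (0 : ℝ) 1) (h : collapseRadius β t ≤ a ^ β) (θ : ℝ) :
    modifiedTransportMap β t (polarPoint β (a, θ)) =
      circleMap 0 (a ^ β) θ + ((t * a : ℝ) : ℂ) / circleMap 0 (a ^ β) θ := by
  have hn := norm_polarPoint β ha.1 θ
  rw [modifiedTransportMap, if_neg (by rw [hn]; exact not_lt.2 h),
    if_pos (norm_polarPoint_le (by linarith) ha θ), transportMap, hn, ← Real.rpow_mul ha.1.le,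
    mul_one_div_cancel (by linarith), Real.rpow_one]
  rfl

/-- Take `ρ = max(a^β, √(ta))`. In the collapsed regime `ρ² = ta`, so `w + ta/w` degenerates to
`2√(ta) cos θ`, and both `log ρ` and `β log a` are dominated by every `x ≥ log √(ta)`. -/
theorem exists_joukowski_radius {β t a : ℝ} (hβ : 1 / 2 < β) (ht : t ∈ Ioo (0 : ℝ) 1)
    (ha : a ∈ Ioo (0 : ℝ) 1) :
    ∃ ρ : ℝ, Real.sqrt (t * a) ≤ ρ ∧ ρ ≤ 1 ∧
      (∀ x, Real.log (Real.sqrt (t * a)) ≤ x → max (Real.log ρ) x = max (β * Real.log a) x) ∧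
      ∀ θ, modifiedTransportMap β t (polarPoint β (a, θ)) =
        circleMap 0 ρ θ + ((t * a : ℝ) : ℂ) / circleMap 0 ρ θ := by
  have hc : 0 < t * a := mul_pos ht.1 ha.1
  have hs := Real.sqrt_pos.2 hc
  have hlog : Real.log (Real.sqrt (t * a)) = (Real.log t + Real.log a) / 2 := by
    rw [Real.log_sqrt hc.le, Real.log_mul ht.1.ne' ha.1.ne']
  rcases lt_or_ge (a ^ β) (collapseRadius β t) with h | h
  · refine ⟨Real.sqrt (t * a), le_rfl, ?_, fun x hx => ?_, fun θ => ?_⟩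
    · rw [Real.sqrt_le_one]
      nlinarith [ht.1, ht.2, ha.1, ha.2]
    · have h1 := (rpow_lt_collapseRadius_iff hβ ht.1 ha.1).1 h
      rw [max_eq_right hx, max_eq_right]
      linarith
    · rw [modifiedTransportMap_polarPoint_of_lt hβ ht.1 ha.1 h, ← circleMap_add_sq_div _ hs.ne',
        Real.sq_sqrt hc.le]
  · refine ⟨a ^ β, ?_, Real.rpow_le_one ha.1.le ha.2.le (by linarith), fun x hx => ?_,
      modifiedTransportMap_polarPoint_of_ge hβ ha h⟩
    · rw [← Real.log_le_log_iff hs (Real.rpow_pos_of_pos ha.1 β), hlog, Real.log_rpow ha.1]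
      have h1 := (rpow_lt_collapseRadius_iff hβ ht.1 ha.1).not.1 (not_lt.2 h)
      linarith
    · rw [Real.log_rpow ha.1]

theorem norm_modifiedTransportMap_polarPoint_le {β t a : ℝ} (hβ : 1 / 2 < β)
    (ht : t ∈ Ioo (0 : ℝ) 1) (ha : a ∈ Ioo (0 : ℝ) 1) (θ : ℝ) :
    ‖modifiedTransportMap β t (polarPoint β (a, θ))‖ ≤ 2 := by
  obtain ⟨ρ, h1, h2, -, h3⟩ := exists_joukowski_radius hβ ht ha
  have hc : 0 < t * a := mul_pos ht.1 ha.1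
  have hρ : 0 < ρ := (Real.sqrt_pos.2 hc).trans_le h1
  rw [h3]
  refine (norm_add_le _ _).trans ?_
  rw [norm_div, norm_circleMap_zero, abs_of_pos hρ, Complex.norm_of_nonneg hc.le]
  have h4 : t * a / ρ ≤ ρ := by
    rw [div_le_iff₀ hρ, ← Real.sq_sqrt hc.le]
    nlinarith [Real.sqrt_nonneg (t * a)]
  linarith

theorem isHeatMeasure_map_initialMeasure {β t : ℝ} (hβ : 1 / 2 < β) (ht : t ∈ Ioo (0 : ℝ) 1) :
    IsHeatMeasure (littlewoodOffordProfile β) t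
      ((initialMeasure β).map (modifiedTransportMap β t)) := by
  have hm := (measurable_modifiedTransportMap β t).comp (measurable_polarPoint β)
  rw [initialMeasure,
    Measure.map_map (measurable_modifiedTransportMap β t) (measurable_polarPoint β)]
  refine ⟨Measure.isProbabilityMeasure_map hm.aemeasurable, map_baseMeasure_compl_closedBall hm
    (fun a ha θ => norm_modifiedTransportMap_polarPoint_le hβ ht ha θ), fun z => ?_⟩
  rw [heatPotential_eq hβ ht.1]
  refine hasLogPotentialAt_map_baseMeasure hm
    (fun a ha θ => norm_modifiedTransportMap_polarPoint_le hβ ht ha θ)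
    (intervalIntegrable_log_norm_largeRoot ht.1 zero_le_one z) (fun a ha => ?_) fun a ha => ?_ <;>
    obtain ⟨ρ, h1, -, h2, h3⟩ := exists_joukowski_radius hβ ht ha <;>
    have hc : 0 < t * a := mul_pos ht.1 ha.1 <;>
    simp_rw [Function.comp_apply, h3]
  · exact integrable_log_norm_sub_joukowski hc ((Real.sqrt_pos.2 hc).trans_le h1) z
  · rw [integral_log_norm_sub_joukowski hc h1]
    exact h2 _ (Real.log_le_log (Real.sqrt_pos.2 hc) (sqrt_le_norm_largeRoot _ _))

theorem IsInitialMeasure.eq_initialMeasure {β : ℝ} (hβ : 0 < β) {ν : Measure ℂ}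
    (h : IsInitialMeasure (littlewoodOffordProfile β) ν) : ν = initialMeasure β :=
  have := h.isProbabilityMeasure
  measure_ext_of_logPotential h.compactSupport (isInitialMeasure_initialMeasure hβ).compactSupport
    h.logPotential (isInitialMeasure_initialMeasure hβ).logPotential

theorem IsHeatMeasure.eq_map_initialMeasure {β t : ℝ} (hβ : 1 / 2 < β) (ht : t ∈ Ioo (0 : ℝ) 1)
    {ν : Measure ℂ} (h : IsHeatMeasure (littlewoodOffordProfile β) t ν) :
    ν = (initialMeasure β).map (modifiedTransportMap β t) :=
  have h' := isHeatMeasure_map_initialMeasure hβ ht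
  have := h.isProbabilityMeasure
  have := h'.isProbabilityMeasure
  measure_ext_of_logPotential h.compactSupport h'.compactSupport
    (fun z _ => h.logPotential z) (fun z _ => h'.logPotential z)

/-! ### Absolute continuity of the image of the annulus -/

theorem baseMeasure_eq : baseMeasure = ENNReal.ofReal (2 * Real.pi)⁻¹ •
    (volume : Measure (ℝ × ℝ)).restrict (Ioo 0 1 ×ˢ Ioo (-Real.pi) Real.pi) := by
  rw [baseMeasure, angleMeasure, Measure.prod_smul_right, Measure.prod_restrict]
  rfl

/-- The parametrization of the plane by a family of ellipses with half-axes `A` and `B`. -/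
def ellipseMap (A B : ℝ → ℝ) (p : ℝ × ℝ) : ℝ × ℝ := (A p.1 * Real.cos p.2, B p.1 * Real.sin p.2)

/-- The derivative of `ellipseMap`. -/
def fderivEllipseMap (A B A' B' : ℝ → ℝ) (p : ℝ × ℝ) : ℝ × ℝ →L[ℝ] ℝ × ℝ :=
  (Matrix.toLin (.finTwoProd ℝ) (.finTwoProd ℝ)
    !![A' p.1 * Real.cos p.2, -A p.1 * Real.sin p.2;
      B' p.1 * Real.sin p.2, B p.1 * Real.cos p.2]).toContinuousLinearMap

theorem hasFDerivAt_ellipseMap {A B A' B' : ℝ → ℝ} {p : ℝ × ℝ} (hA : HasDerivAt A (A' p.1) p.1)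
    (hB : HasDerivAt B (B' p.1) p.1) :
    HasFDerivAt (ellipseMap A B) (fderivEllipseMap A B A' B' p) p := by
  unfold fderivEllipseMap
  rw [Matrix.toLin_finTwoProd_toContinuousLinearMap]
  have h1 := (hA.comp_hasFDerivAt p hasFDerivAt_fst).mul
    ((Real.hasDerivAt_cos p.2).comp_hasFDerivAt p (hasFDerivAt_snd (𝕜 := ℝ)))
  have h2 := (hB.comp_hasFDerivAt p hasFDerivAt_fst).mul
    ((Real.hasDerivAt_sin p.2).comp_hasFDerivAt p (hasFDerivAt_snd (𝕜 := ℝ)))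
  refine (h1.prodMk h2).congr_fderiv ?_
  ext <;> simp <;> ring

theorem det_fderivEllipseMap (A B A' B' : ℝ → ℝ) (p : ℝ × ℝ) :
    (fderivEllipseMap A B A' B' p).det =
      A' p.1 * B p.1 * Real.cos p.2 ^ 2 + A p.1 * B' p.1 * Real.sin p.2 ^ 2 := by
  unfold fderivEllipseMap
  simp only [LinearMap.det_toContinuousLinearMap, LinearMap.det_toLin, Matrix.det_fin_two_of]
  ring

/-- The ellipses are nested. At a common point of two of them, `cos²` and `sin²` would both weakly
decrease from the smaller to the larger; as each pair sums to one, both are unchanged, which forces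
both to vanish. -/
theorem injOn_ellipseMap {A B : ℝ → ℝ} {l u : ℝ} (hA : StrictMonoOn A (Ioo l u))
    (hB : StrictMonoOn B (Ioo l u)) (hA0 : ∀ a ∈ Ioo l u, 0 < A a)
    (hB0 : ∀ a ∈ Ioo l u, 0 < B a) :
    InjOn (ellipseMap A B) (Ioo l u ×ˢ Ioo (-Real.pi) Real.pi) := by
  have hlt : ∀ a ∈ Ioo l u, ∀ b ∈ Ioo l u, ∀ θ θ' : ℝ, a < b →
      ellipseMap A B (a, θ) ≠ ellipseMap A B (b, θ') := by
    intro a ha b hb θ θ' hab h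
    have h1 : A a * Real.cos θ = A b * Real.cos θ' := congrArg Prod.fst h
    have h2 : B a * Real.sin θ = B b * Real.sin θ' := congrArg Prod.snd h
    have hA1 := hA ha hb hab
    have hB1 := hB ha hb hab
    have key : ∀ x y c d : ℝ, 0 < x → x < y → x * c = y * d →
        d ^ 2 ≤ c ^ 2 ∧ (d ^ 2 = c ^ 2 → c = 0) := by
      intro x y c d hx hxy he
      have hy : 0 < y := hx.trans hxy
      have hsq : x ^ 2 * c ^ 2 = y ^ 2 * d ^ 2 := by rw [← mul_pow, he, mul_pow]
      have hlt : x ^ 2 < y ^ 2 := by gcongr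
      refine ⟨by nlinarith [sq_nonneg c, sq_nonneg d], fun hcd => ?_⟩
      rw [hcd] at hsq
      have : (y ^ 2 - x ^ 2) * c ^ 2 = 0 := by linear_combination -hsq
      rcases mul_eq_zero.1 this with h | h
      · linarith
      · simpa using h
    obtain ⟨c1, c2⟩ := key _ _ _ _ (hA0 a ha) hA1 h1
    obtain ⟨s1, s2⟩ := key _ _ _ _ (hB0 a ha) hB1 h2
    have e1 := Real.cos_sq_add_sin_sq θ
    have e2 := Real.cos_sq_add_sin_sq θ'
    have hc := c2 (by linarith)
    have hs := s2 (by linarith)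
    rw [hc, hs] at e1
    norm_num at e1
  rintro ⟨a, θ⟩ ⟨ha, hθ⟩ ⟨b, θ'⟩ ⟨hb, hθ'⟩ h
  rcases lt_trichotomy a b with hab | rfl | hab
  · exact absurd h (hlt a ha b hb θ θ' hab)
  · have h1 : A a * Real.cos θ = A a * Real.cos θ' := congrArg Prod.fst h
    have h2 : B a * Real.sin θ = B a * Real.sin θ' := congrArg Prod.snd h
    have hc := mul_left_cancel₀ (hA0 a ha).ne' h1
    have hs := mul_left_cancel₀ (hB0 a ha).ne' h2
    -- On a single ellipse the angle is recovered from its cosine and sine by injectivity of polar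
    -- coordinates at radius one.
    have := polarCoord.symm.injOn (x₁ := ((1 : ℝ), θ)) (x₂ := ((1 : ℝ), θ'))
      ⟨one_pos (α := ℝ), hθ⟩ ⟨one_pos (α := ℝ), hθ'⟩
      (by simp [polarCoord, hc, hs])
    exact congrArg (fun p : ℝ × ℝ => (a, p.2)) this
  · exact absurd h.symm (hlt b hb a ha θ' θ hab)

/-- By the change of variables formula the Jacobian integrates over the preimage to the volume of a
subset of `N`, hence to zero; a positive Jacobian leaves only a null set. -/
theorem volume_ellipseMap_preimage {A B A' B' : ℝ → ℝ} {l u : ℝ} (hAm : Measurable A)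
    (hBm : Measurable B) (hA : ∀ a ∈ Ioo l u, HasDerivAt A (A' a) a)
    (hB : ∀ a ∈ Ioo l u, HasDerivAt B (B' a) a) (hA0 : ∀ a ∈ Ioo l u, 0 < A a)
    (hB0 : ∀ a ∈ Ioo l u, 0 < B a) (hA' : ∀ a ∈ Ioo l u, 0 < A' a)
    (hB' : ∀ a ∈ Ioo l u, 0 < B' a) {N : Set (ℝ × ℝ)} (hNm : MeasurableSet N)
    (hN : volume N = 0) :
    volume (Ioo l u ×ˢ Ioo (-Real.pi) Real.pi ∩ ellipseMap A B ⁻¹' N) = 0 := by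
  have hmono : ∀ {F F' : ℝ → ℝ}, (∀ a ∈ Ioo l u, HasDerivAt F (F' a) a) →
      (∀ a ∈ Ioo l u, 0 < F' a) → StrictMonoOn F (Ioo l u) := by
    intro F F' hF hF'
    refine strictMonoOn_of_deriv_pos (convex_Ioo l u)
      (fun a ha => (hF a ha).continuousAt.continuousWithinAt) fun a ha => ?_
    rw [interior_Ioo] at ha
    rw [(hF a ha).deriv]
    exact hF' a ha
  set s := Ioo l u ×ˢ Ioo (-Real.pi) Real.pi with hs
  have hEm : Measurable (ellipseMap A B) := by
    unfold ellipseMap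
    fun_prop
  have hm : MeasurableSet (s ∩ ellipseMap A B ⁻¹' N) :=
    (measurableSet_Ioo.prod measurableSet_Ioo).inter (hEm hNm)
  have hd : ∀ p ∈ s ∩ ellipseMap A B ⁻¹' N, HasFDerivWithinAt (ellipseMap A B)
      (fderivEllipseMap A B A' B' p) (s ∩ ellipseMap A B ⁻¹' N) p := fun p hp =>
    (hasFDerivAt_ellipseMap (hA _ hp.1.1) (hB _ hp.1.1)).hasFDerivWithinAt
  have h := lintegral_abs_det_fderiv_eq_addHaar_image volume hm hd
    ((injOn_ellipseMap (hmono hA hA') (hmono hB hB') hA0 hB0).mono inter_subset_left)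
  rw [measure_mono_null ((image_mono inter_subset_right).trans (image_preimage_subset _ _)) hN,
    lintegral_eq_zero_iff' (aemeasurable_ofReal_abs_det_fderivWithin volume hm hd)] at h
  rw [← Measure.restrict_eq_zero, ← ae_eq_bot, ← Filter.eventually_false_iff_eq_bot]
  filter_upwards [h, ae_restrict_mem hm] with p hp hmem
  have hpos : 0 < (fderivEllipseMap A B A' B' p).det := by
    rw [det_fderivEllipseMap]
    have h1 : 0 < A' p.1 * B p.1 := mul_pos (hA' _ hmem.1.1) (hB0 _ hmem.1.1)
    have h2 : 0 < A p.1 * B' p.1 := mul_pos (hA0 _ hmem.1.1) (hB' _ hmem.1.1)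
    have h3 := Real.cos_sq_add_sin_sq p.2
    rcases (sq_nonneg (Real.cos p.2)).eq_or_lt with h4 | h4
    · rw [← h4, zero_add] at h3
      rw [← h4, h3]
      linarith
    · have := mul_pos h1 h4
      have := mul_nonneg h2.le (sq_nonneg (Real.sin p.2))
      linarith
  have : ENNReal.ofReal |(fderivEllipseMap A B A' B' p).det| = 0 := hp
  rw [ENNReal.ofReal_eq_zero] at this
  exact absurd (abs_pos.2 hpos.ne') (not_lt.2 this)

theorem collapseRadius_eq_rpow (β : ℝ) {t : ℝ} (ht : 0 < t) :
    collapseRadius β t = (t ^ (1 / (2 * β - 1))) ^ β := by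
  rw [← Real.rpow_mul ht.le, collapseRadius]
  congr 1
  ring

theorem collapseRadius_sq {β t : ℝ} (hβ : 1 / 2 < β) (ht : 0 < t) :
    collapseRadius β t ^ 2 = t * t ^ (1 / (2 * β - 1)) := by
  have h : 2 * β - 1 ≠ 0 := by linarith
  rw [collapseRadius, ← Real.rpow_natCast, ← Real.rpow_mul ht.le]
  nth_rw 2 [← Real.rpow_one t]
  rw [← Real.rpow_add ht]
  congr 1
  rw [div_mul_eq_mul_div, div_eq_iff h, add_mul, div_mul_cancel₀ _ h]
  push_cast
  ring

theorem baseMeasure_apply_le (T : Set (ℝ × ℝ)) :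
    baseMeasure T ≤ ENNReal.ofReal (2 * Real.pi)⁻¹ *
      volume (T ∩ Ioo 0 1 ×ˢ Ioo (-Real.pi) Real.pi) := by
  rw [baseMeasure_eq, Measure.smul_apply, smul_eq_mul,
    Measure.restrict_apply' (measurableSet_Ioo.prod measurableSet_Ioo)]

/-- With `X = a^β` and `Y = t a^{1-β}`, so that `XY = ta`, circles go to ellipses with half-axes `X
± Y`. Outside the collapse radius `0 < Y < X`. -/
theorem absolutelyContinuous_map_annulus {β t : ℝ} (hβ : 1 / 2 < β) (ht : t ∈ Ioo (0 : ℝ) 1) :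
    ((initialMeasure β).restrict {w : ℂ | collapseRadius β t < ‖w‖ ∧ ‖w‖ < 1}).map
      (transportMap β t) ≪ volume := by
  have hβ0 : 0 < β := by linarith
  set S : Set ℂ := {w : ℂ | collapseRadius β t < ‖w‖ ∧ ‖w‖ < 1} with hS
  have hSm : MeasurableSet S :=
    (measurableSet_lt measurable_const measurable_norm).inter
      (measurableSet_lt measurable_norm measurable_const)
  refine Measure.AbsolutelyContinuous.mk fun N hN hN0 => ?_
  rw [Measure.map_apply (measurable_transportMap β t) hN,
    Measure.restrict_apply (measurable_transportMap β t hN), initialMeasure,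
    Measure.map_apply (measurable_polarPoint β) ((measurable_transportMap β t hN).inter hSm)]
  refine le_antisymm ((baseMeasure_apply_le _).trans (le_of_eq ?_)) zero_le
  set l : ℝ := t ^ (1 / (2 * β - 1)) with hl
  have hl0 : 0 < l := Real.rpow_pos_of_pos ht.1 _
  set N' : Set (ℝ × ℝ) := Complex.measurableEquivRealProd.symm ⁻¹' N with hN'
  have hN'0 : volume N' = 0 := by
    rw [hN', Complex.volume_preserving_equiv_real_prod.symm.measure_preimage hN.nullMeasurableSet,
      hN0]
  have hder : ∀ γ : ℝ, ∀ a ∈ Ioo l 1, HasDerivAt (fun a : ℝ => a ^ γ) (γ * a ^ γ / a) a := by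
    intro γ a ha
    have ha0 := hl0.trans ha.1
    refine (Real.hasDerivAt_rpow_const (Or.inl ha0.ne')).congr_deriv ?_
    rw [Real.rpow_sub_one ha0.ne', mul_div_assoc]
  have hXY : ∀ a ∈ Ioo l 1, 0 < t * a ^ (1 - β) ∧ t * a ^ (1 - β) < a ^ β := by
    intro a ha
    have ha0 := hl0.trans ha.1
    have h1 := mul_pos ht.1 (Real.rpow_pos_of_pos ha0 (1 - β))
    refine ⟨h1, ?_⟩
    have h2 : collapseRadius β t < a ^ β := by
      rw [collapseRadius_eq_rpow β ht.1]
      exact Real.rpow_lt_rpow hl0.le ha.1 hβ0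
    have h3 : Real.log t < (2 * β - 1) * Real.log a := by
      have h4 := Real.log_lt_log hl0 ha.1
      rw [hl, Real.log_rpow ht.1, div_mul_eq_mul_div, one_mul, div_lt_iff₀ (by linarith)] at h4
      linarith
    rw [← Real.log_lt_log_iff h1 (Real.rpow_pos_of_pos ha0 β), Real.log_rpow ha0,
      Real.log_mul ht.1.ne' (Real.rpow_pos_of_pos ha0 _).ne', Real.log_rpow ha0]
    linarith
  have hnull := volume_ellipseMap_preimage (l := l) (u := 1)
    (A := fun a => a ^ β + t * a ^ (1 - β)) (B := fun a => a ^ β - t * a ^ (1 - β))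
    (A' := fun a => β * a ^ β / a + t * ((1 - β) * a ^ (1 - β) / a))
    (B' := fun a => β * a ^ β / a - t * ((1 - β) * a ^ (1 - β) / a))
    (by fun_prop) (by fun_prop)
    (fun a ha => (hder β a ha).add ((hder (1 - β) a ha).const_mul t))
    (fun a ha => (hder β a ha).sub ((hder (1 - β) a ha).const_mul t))
    (fun a ha => by linarith [hXY a ha])
    (fun a ha => by linarith [hXY a ha])
    (fun a ha => by
      have e : β * a ^ β / a + t * ((1 - β) * a ^ (1 - β) / a) =
        (β * (a ^ β - t * a ^ (1 - β)) + t * a ^ (1 - β)) / a := by ring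
      obtain ⟨h1, h2⟩ := hXY a ha
      rw [e]
      exact div_pos (add_pos (mul_pos hβ0 (sub_pos.2 h2)) h1) (hl0.trans ha.1))
    (fun a ha => by
      have e : β * a ^ β / a - t * ((1 - β) * a ^ (1 - β) / a) =
        (β * (a ^ β + t * a ^ (1 - β)) - t * a ^ (1 - β)) / a := by ring
      obtain ⟨h1, h2⟩ := hXY a ha
      rw [e]
      refine div_pos ?_ (hl0.trans ha.1)
      -- `β (X + Y) > (X + Y)/2 > Y`, from `β > 1/2` and `X > Y`.
      nlinarith)
    (Complex.measurableEquivRealProd.symm.measurable hN) hN'0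
  refine mul_eq_zero_of_right _ (measure_mono_null ?_ hnull)
  rintro ⟨a, θ⟩ ⟨⟨h1, h2⟩, h3, h4⟩
  have ha0 : 0 < a := h3.1
  have hn : ‖polarPoint β (a, θ)‖ = a ^ β := norm_polarPoint β ha0 θ
  have hal : l < a := by
    have h5 : collapseRadius β t < ‖polarPoint β (a, θ)‖ := h2.1
    rw [hn, collapseRadius_eq_rpow β ht.1] at h5
    exact (Real.rpow_lt_rpow_iff hl0.le ha0.le hβ0).1 h5
  refine ⟨⟨⟨hal, h3.2⟩, h4⟩, ?_⟩
  have h6 : transportMap β t (polarPoint β (a, θ)) ∈ N := h1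
  have h7 : t * a = a ^ β * (t * a ^ (1 - β)) := by
    rw [mul_left_comm, ← Real.rpow_add ha0, add_sub_cancel, Real.rpow_one]
  rw [transportMap, hn, ← Real.rpow_mul ha0.le, mul_one_div_cancel hβ0.ne', Real.rpow_one, h7,
    polarPoint, circleMap_add_mul_div _ _ (Real.rpow_pos_of_pos ha0 β).ne',
    ← Complex.mk_eq_add_mul_I] at h6
  exact h6

/-! ### The collapsed disc and the semicircle law -/

theorem volume_setOf_sq_lt (c : ℝ) : volume {y : ℝ | y ^ 2 < c} = ENNReal.ofReal (2 * Real.sqrt c) := by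
  have h : {y : ℝ | y ^ 2 < c} = Ioo (-Real.sqrt c) (Real.sqrt c) := by
    ext y
    rw [mem_ofPred_eq, mem_Ioo, Real.sq_lt]
  rw [h, Real.volume_Ioo]
  congr 1
  ring

/-- Both sides integrate `φ` of the first coordinate over the disc of radius `R`, in polar and in
Cartesian coordinates. -/
theorem lintegral_polar_fst {R : ℝ} (hR : 0 < R) {φ : ℝ → ENNReal} (hφ : Measurable φ) :
    ∫⁻ ρ in Ioo 0 R, ENNReal.ofReal ρ *
        ∫⁻ θ in Ioo (-Real.pi) Real.pi, φ (ρ * Real.cos θ) =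
      ∫⁻ x, ENNReal.ofReal (2 * Real.sqrt (R ^ 2 - x ^ 2)) * φ x := by
  set f : ℝ × ℝ → ENNReal := fun p => {q : ℝ × ℝ | q.2 ^ 2 < R ^ 2 - q.1 ^ 2}.indicator 1 p * φ p.1
    with hf
  have hD : MeasurableSet {q : ℝ × ℝ | q.2 ^ 2 < R ^ 2 - q.1 ^ 2} :=
    measurableSet_lt (by fun_prop) (by fun_prop)
  have hfm : Measurable f := (measurable_one.indicator hD).mul (hφ.comp measurable_fst)
  have h1 : ∫⁻ p, f p = ∫⁻ x, ENNReal.ofReal (2 * Real.sqrt (R ^ 2 - x ^ 2)) * φ x := by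
    rw [Measure.volume_eq_prod, lintegral_prod _ hfm.aemeasurable]
    refine lintegral_congr fun x => ?_
    have hDx : MeasurableSet {y : ℝ | y ^ 2 < R ^ 2 - x ^ 2} :=
      measurableSet_lt (by fun_prop) (by fun_prop)
    rw [← volume_setOf_sq_lt, ← lintegral_indicator_one hDx, ← lintegral_mul_const _
      (measurable_one.indicator hDx)]
    rfl
  rw [← h1, ← lintegral_comp_polarCoord_symm]
  have h2 : ∀ p ∈ polarCoord.target, ENNReal.ofReal p.1 • f (polarCoord.symm p) =
      (Iio R ×ˢ univ).indicator (fun p => ENNReal.ofReal p.1 * φ (p.1 * Real.cos p.2)) p := by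
    rintro ⟨ρ, θ⟩ ⟨h3, -⟩
    have hρ : 0 < ρ := h3
    have hiff : (ρ * Real.sin θ) ^ 2 < R ^ 2 - (ρ * Real.cos θ) ^ 2 ↔ ρ ^ 2 < R ^ 2 := by
      have := Real.cos_sq_add_sin_sq θ
      have e : (ρ * Real.sin θ) ^ 2 = ρ ^ 2 - (ρ * Real.cos θ) ^ 2 := by
        linear_combination ρ ^ 2 * this
      rw [e]
      constructor <;> intro h <;> linarith
    have hiff2 : (ρ * Real.sin θ) ^ 2 < R ^ 2 - (ρ * Real.cos θ) ^ 2 ↔ ρ < R :=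
      hiff.trans (pow_lt_pow_iff_left₀ hρ.le hR.le two_ne_zero)
    change ENNReal.ofReal ρ * ({q : ℝ × ℝ | q.2 ^ 2 < R ^ 2 - q.1 ^ 2}.indicator 1
      (ρ * Real.cos θ, ρ * Real.sin θ) * φ (ρ * Real.cos θ)) = _
    by_cases hlt : ρ < R
    · rw [indicator_of_mem (by exact hiff2.2 hlt), indicator_of_mem (by exact ⟨hlt, mem_univ _⟩),
        Pi.one_apply, one_mul]
    · rw [indicator_of_notMem (by exact fun h => hlt (hiff2.1 h)),
        indicator_of_notMem (by exact fun h => hlt h.1), zero_mul, mul_zero]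
  have hset : Iio R ×ˢ univ ∩ polarCoord.target = Ioo 0 R ×ˢ Ioo (-Real.pi) Real.pi := by
    ext ⟨ρ, θ⟩
    simp only [polarCoord_target, mem_inter_iff, mem_prod, mem_Iio, mem_univ, mem_Ioi, mem_Ioo]
    tauto
  have hm : Measurable fun p : ℝ × ℝ => ENNReal.ofReal p.1 * φ (p.1 * Real.cos p.2) :=
    (ENNReal.measurable_ofReal.comp measurable_fst).mul (hφ.comp (by fun_prop))
  rw [setLIntegral_congr_fun polarCoord.open_target.measurableSet h2,
    lintegral_indicator (measurableSet_Iio.prod MeasurableSet.univ),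
    Measure.restrict_restrict (measurableSet_Iio.prod MeasurableSet.univ), hset,
    Measure.volume_eq_prod, ← Measure.prod_restrict, lintegral_prod _ hm.aemeasurable]
  refine lintegral_congr fun ρ => ?_
  rw [lintegral_const_mul' _ _ ENNReal.ofReal_ne_top]

/-- Substituting `ρ = 2√(ta)` gives `da = ρ/(2t) dρ`, the polar area element up to a constant. -/
theorem lintegral_circle_cos {t a₀ R : ℝ} (ht : 0 < t) (hR : 0 < R)
    (h : R ^ 2 = 4 * t * a₀) {φ : ℝ → ENNReal} (hφ : Measurable φ) :
    ∫⁻ a in Ioo 0 a₀, ∫⁻ θ in Ioo (-Real.pi) Real.pi, φ (2 * Real.sqrt (t * a) * Real.cos θ) =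
      ENNReal.ofReal (2 * t)⁻¹ * ∫⁻ x, ENNReal.ofReal (2 * Real.sqrt (R ^ 2 - x ^ 2)) * φ x := by
  have himg : (fun ρ : ℝ => ρ ^ 2 / (4 * t)) '' Ioo 0 R = Ioo 0 a₀ := by
    ext a
    constructor
    · rintro ⟨ρ, ⟨h1, h2⟩, rfl⟩
      refine ⟨by positivity, ?_⟩
      rw [div_lt_iff₀ (by positivity), mul_comm, ← h]
      gcongr
    · rintro ⟨h1, h2⟩
      have hta : 0 < t * a := mul_pos ht h1
      refine ⟨2 * Real.sqrt (t * a), ⟨by positivity, ?_⟩, ?_⟩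
      · apply lt_of_pow_lt_pow_left₀ 2 hR.le
        rw [mul_pow, Real.sq_sqrt hta.le, h]
        nlinarith
      · simp only
        rw [mul_pow, Real.sq_sqrt hta.le]
        field_simp
        norm_num
  rw [← himg, lintegral_image_eq_lintegral_abs_deriv_mul (f' := fun ρ => ρ / (2 * t))
    measurableSet_Ioo, ← lintegral_polar_fst hR hφ, ← lintegral_const_mul']
  · refine setLIntegral_congr_fun measurableSet_Ioo fun ρ hρ => ?_
    have h1 : 2 * Real.sqrt (t * (ρ ^ 2 / (4 * t))) = ρ := by
      have : t * (ρ ^ 2 / (4 * t)) = (ρ / 2) ^ 2 := by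
        field_simp
        norm_num
      rw [this, Real.sqrt_sq (by linarith [hρ.1])]
      ring
    have hρ0 : 0 < ρ := hρ.1
    simp only [h1]
    rw [abs_of_pos (by positivity), div_eq_inv_mul, ENNReal.ofReal_mul (by positivity), mul_assoc]
  · exact ENNReal.ofReal_ne_top
  · intro ρ _
    refine HasDerivAt.hasDerivWithinAt ?_
    refine ((hasDerivAt_pow 2 ρ).div_const (4 * t)).congr_deriv ?_
    field_simp
    push_cast
    ring
  · intro x hx y hy hxy
    simp only at hxy
    rw [div_left_inj' (by positivity)] at hxy
    exact (pow_left_inj₀ hx.1.le hy.1.le two_ne_zero).1 hxy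

theorem map_collapsed_disc {β t : ℝ} (hβ : 1 / 2 < β) (ht : t ∈ Ioo (0 : ℝ) 1) :
    ((initialMeasure β).restrict {w : ℂ | ‖w‖ < collapseRadius β t}).map
        (modifiedTransportMap β t) =
      ENNReal.ofReal (t ^ (1 / (2 * β - 1))) •
        (semicircleLaw (2 * collapseRadius β t)).map (fun x : ℝ => (x : ℂ)) := by
  have hβ0 : 0 < β := by linarith
  have hr := collapseRadius_pos β ht.1
  have hrsq := collapseRadius_sq hβ ht.1
  have hreq := collapseRadius_eq_rpow β ht.1
  set r := collapseRadius β t with hrdef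
  set l : ℝ := t ^ (1 / (2 * β - 1)) with hl
  have hl0 : 0 < l := Real.rpow_pos_of_pos ht.1 _
  have hl1 : l < 1 := Real.rpow_lt_one ht.1.le ht.2 (by
    apply one_div_pos.2; linarith)
  have hTm := measurable_modifiedTransportMap β t
  have hPm := measurable_polarPoint β
  have hSm : MeasurableSet {w : ℂ | ‖w‖ < r} := measurableSet_lt measurable_norm measurable_const
  have hcm : Measurable fun x : ℝ => (x : ℂ) := Complex.measurable_ofReal
  ext A hA
  set B : Set ℝ := (fun x : ℝ => (x : ℂ)) ⁻¹' A with hB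
  have hBm : MeasurableSet B := hcm hA
  have hφ : Measurable (B.indicator (1 : ℝ → ENNReal)) := measurable_one.indicator hBm
  have hlhs : (((initialMeasure β).restrict {w : ℂ | ‖w‖ < r}).map (modifiedTransportMap β t)) A =
      ENNReal.ofReal (2 * Real.pi)⁻¹ * ∫⁻ a in Ioo 0 l, ∫⁻ θ in Ioo (-Real.pi) Real.pi,
        B.indicator (1 : ℝ → ENNReal) (2 * Real.sqrt (t * a) * Real.cos θ) := by
    have hm2 : MeasurableSet ({p : ℝ × ℝ | 2 * Real.sqrt (t * p.1) * Real.cos p.2 ∈ B}) :=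
      (by fun_prop : Measurable fun p : ℝ × ℝ => 2 * Real.sqrt (t * p.1) * Real.cos p.2) hBm
    have hset : polarPoint β ⁻¹' (modifiedTransportMap β t ⁻¹' A ∩ {w : ℂ | ‖w‖ < r}) ∩
        Ioo 0 1 ×ˢ Ioo (-Real.pi) Real.pi =
        {p : ℝ × ℝ | 2 * Real.sqrt (t * p.1) * Real.cos p.2 ∈ B} ∩
          Ioo 0 l ×ˢ Ioo (-Real.pi) Real.pi := by
      ext ⟨a, θ⟩
      have hn : 0 < a → ‖polarPoint β (a, θ)‖ = a ^ β := fun h => norm_polarPoint β h θ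
      have hlt : 0 < a → (a ^ β < r ↔ a < l) := fun h => by
        rw [hreq, Real.rpow_lt_rpow_iff h.le hl0.le hβ0]
      have hT : 0 < a → a ^ β < r → modifiedTransportMap β t (polarPoint β (a, θ)) =
          ((2 * Real.sqrt (t * a) * Real.cos θ : ℝ) : ℂ) := fun h h' =>
        modifiedTransportMap_polarPoint_of_lt hβ ht.1 h h' θ
      constructor
      · rintro ⟨⟨h1, h2⟩, ⟨h3, h4⟩, h5⟩
        have h6 : ‖polarPoint β (a, θ)‖ < r := h2
        rw [hn h3] at h6
        have h7 : modifiedTransportMap β t (polarPoint β (a, θ)) ∈ A := h1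
        rw [hT h3 h6] at h7
        exact ⟨h7, ⟨h3, (hlt h3).1 h6⟩, h5⟩
      · rintro ⟨h1, ⟨h3, h4⟩, h5⟩
        have h6 : a ^ β < r := (hlt h3).2 h4
        refine ⟨⟨?_, ?_⟩, ⟨h3, lt_trans h4 hl1⟩, h5⟩
        · change modifiedTransportMap β t (polarPoint β (a, θ)) ∈ A
          rw [hT h3 h6]
          exact h1
        · change ‖polarPoint β (a, θ)‖ < r
          rwa [hn h3]
    rw [Measure.map_apply hTm hA, Measure.restrict_apply (hTm hA), initialMeasure,
      Measure.map_apply hPm ((hTm hA).inter hSm), baseMeasure_eq, Measure.smul_apply, smul_eq_mul,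
      Measure.restrict_apply' (measurableSet_Ioo.prod measurableSet_Ioo), hset,
      ← Measure.restrict_apply hm2, Measure.volume_eq_prod, ← Measure.prod_restrict,
      Measure.prod_apply hm2]
    congr 1
    refine lintegral_congr fun a => ?_
    rw [← lintegral_indicator_one (measurable_prodMk_left hm2)]
    rfl
  have hrhs : (semicircleLaw (2 * r)).map (fun x : ℝ => (x : ℂ)) A =
      ENNReal.ofReal (Real.pi * (2 * r) ^ 2)⁻¹ *
        ∫⁻ x, ENNReal.ofReal (2 * Real.sqrt ((2 * r) ^ 2 - x ^ 2)) * B.indicator 1 x := by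
    rw [Measure.map_apply hcm hA, ← hB, semicircleLaw, withDensity_apply _ hBm,
      ← lintegral_const_mul', Measure.restrict_restrict hBm, ← lintegral_indicator
      (hBm.inter measurableSet_Icc)]
    · refine lintegral_congr fun x => ?_
      by_cases hx : x ∈ B
      · rw [indicator_of_mem hx, Pi.one_apply, mul_one, ← ENNReal.ofReal_mul (by positivity),
          ← div_eq_inv_mul]
        by_cases hx2 : x ∈ Icc (-(2 * r)) (2 * r)
        · rw [indicator_of_mem (mem_inter hx hx2)]
        · rw [indicator_of_notMem fun h => hx2 h.2, Real.sqrt_eq_zero_of_nonpos, mul_zero, zero_div,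
            ENNReal.ofReal_zero]
          by_contra hc
          exact hx2 (abs_le.1 (abs_le_of_sq_le_sq (by linarith) (by positivity)))
      · rw [indicator_of_notMem hx, indicator_of_notMem fun h => hx h.1, mul_zero, mul_zero]
    · exact ENNReal.ofReal_ne_top
  rw [hlhs, Measure.smul_apply, smul_eq_mul, hrhs, lintegral_circle_cos (R := 2 * r) ht.1
    (by positivity) (by rw [mul_pow, hrsq]; ring) hφ, ← mul_assoc, ← mul_assoc,
    ← ENNReal.ofReal_mul (by positivity), ← ENNReal.ofReal_mul hl0.le]
  -- The constants match because `r² = t l`: `(2π)⁻¹ (2t)⁻¹ = l / (π (2r)²)`.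
  congr 2
  rw [mul_pow, hrsq]
  have := Real.pi_pos
  have := ht.1
  field_simp

/-! ### The Lebesgue decomposition of `ν_t` -/

theorem volume_im_eq_zero : volume {z : ℂ | z.im = 0} = 0 := by
  have h : {z : ℂ | z.im = 0} = Complex.measurableEquivRealProd ⁻¹' (univ ×ˢ {0}) := by
    ext z
    simp [Complex.measurableEquivRealProd_apply]
  rw [h, Complex.volume_preserving_equiv_real_prod.measure_preimage
    (MeasurableSet.univ.prod (measurableSet_singleton _)).nullMeasurableSet,
    Measure.volume_eq_prod, Measure.prod_prod]
  simp

theorem mutuallySingular_map_ofReal (μ : Measure ℝ) :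
    μ.map (fun x : ℝ => (x : ℂ)) ⟂ₘ (volume : Measure ℂ) := by
  have hm : MeasurableSet {z : ℂ | z.im = 0} :=
    measurableSet_eq_fun Complex.measurable_im measurable_const
  refine ⟨{z : ℂ | z.im = 0}ᶜ, hm.compl, ?_, by rw [compl_compl]; exact volume_im_eq_zero⟩
  rw [Measure.map_apply Complex.measurable_ofReal hm.compl]
  have h : (fun x : ℝ => (x : ℂ)) ⁻¹' {z : ℂ | z.im = 0}ᶜ = ∅ := by
    ext x
    simp
  rw [h, measure_empty]

/-- The critical circle is null for `ν₀`, which is carried by the open unit disc. -/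
theorem restrict_collapsed_disc_compl {β t : ℝ} (hβ : 1 / 2 < β) (ht : t ∈ Ioo (0 : ℝ) 1) :
    (initialMeasure β).restrict {w : ℂ | ‖w‖ < collapseRadius β t}ᶜ =
      (initialMeasure β).restrict {w : ℂ | collapseRadius β t < ‖w‖ ∧ ‖w‖ < 1} := by
  have hβ0 : 0 < β := by linarith
  apply Measure.restrict_congr_set
  have hne : ∀ᵐ p ∂baseMeasure, p.1 ≠ t ^ (1 / (2 * β - 1)) := by
    refine Measure.quasiMeasurePreserving_fst.ae (p := fun a => a ≠ t ^ (1 / (2 * β - 1)))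
      (ae_restrict_of_ae ?_)
    rw [ae_iff]
    simp
  have hmem : ∀ᵐ p ∂baseMeasure, p.1 ∈ Ioo (0 : ℝ) 1 :=
    Measure.quasiMeasurePreserving_fst.ae (ae_restrict_mem measurableSet_Ioo)
  have h : ∀ᵐ w ∂(initialMeasure β), ‖w‖ ≠ collapseRadius β t ∧ ‖w‖ < 1 := by
    rw [initialMeasure, ae_map_iff (p := fun w => ‖w‖ ≠ collapseRadius β t ∧ ‖w‖ < 1)
      (measurable_polarPoint β).aemeasurable
      (((measurableSet_eq_fun measurable_norm measurable_const).compl).inter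
        (measurableSet_lt measurable_norm measurable_const))]
    filter_upwards [hne, hmem] with p h1 h2
    change ‖polarPoint β (p.1, p.2)‖ ≠ _ ∧ ‖polarPoint β (p.1, p.2)‖ < 1
    rw [norm_polarPoint β h2.1, collapseRadius_eq_rpow β ht.1]
    refine ⟨fun h => h1 ?_, Real.rpow_lt_one h2.1.le h2.2 hβ0⟩
    exact (Real.rpow_left_inj h2.1.le (Real.rpow_nonneg ht.1.le _) hβ0.ne').1 h
  filter_upwards [h] with w hw
  apply propext
  change ¬ ‖w‖ < collapseRadius β t ↔ collapseRadius β t < ‖w‖ ∧ ‖w‖ < 1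
  rw [not_lt]
  exact ⟨fun h => ⟨lt_of_le_of_ne h hw.1.symm, hw.2⟩, fun h => h.1.le⟩

theorem map_modifiedTransportMap_eq_add {β t : ℝ} (hβ : 1 / 2 < β) (ht : t ∈ Ioo (0 : ℝ) 1) :
    (initialMeasure β).map (modifiedTransportMap β t) =
      ENNReal.ofReal (t ^ (1 / (2 * β - 1))) •
        (semicircleLaw (2 * collapseRadius β t)).map (fun x : ℝ => (x : ℂ)) +
      ((initialMeasure β).restrict {w : ℂ | collapseRadius β t < ‖w‖ ∧ ‖w‖ < 1}).map
        (transportMap β t) := by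
  have hTm := measurable_modifiedTransportMap β t
  have hSm : MeasurableSet {w : ℂ | ‖w‖ < collapseRadius β t} :=
    measurableSet_lt measurable_norm measurable_const
  have hAm : MeasurableSet {w : ℂ | collapseRadius β t < ‖w‖ ∧ ‖w‖ < 1} :=
    (measurableSet_lt measurable_const measurable_norm).inter
      (measurableSet_lt measurable_norm measurable_const)
  rw [← map_collapsed_disc hβ ht]
  conv_lhs => rw [← Measure.restrict_add_restrict_compl (μ := initialMeasure β) hSm]
  rw [Measure.map_add _ _ hTm, restrict_collapsed_disc_compl hβ ht]
  congr 1
  apply Measure.map_congr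
  filter_upwards [ae_restrict_mem hAm] with w hw
  rw [modifiedTransportMap, if_neg (not_lt.2 hw.1.le), if_pos hw.2.le]

end HeatFlow

end

theorem proposition4p3 (β : ℝ) (hβ : 1 / 2 < β) (t : ℝ) (ht : t ∈ Set.Ioo (0 : ℝ) 1) :
    -- the measures `ν₀` and `ν_t` of the Littlewood--Offord profile are well defined
    (∃! ν₀ : MeasureTheory.Measure ℂ,
      HeatFlow.IsInitialMeasure (HeatFlow.littlewoodOffordProfile β) ν₀) ∧
    (∃! νt : MeasureTheory.Measure ℂ,
      HeatFlow.IsHeatMeasure (HeatFlow.littlewoodOffordProfile β) t νt) ∧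
    ∀ ν₀ νt : MeasureTheory.Measure ℂ,
      HeatFlow.IsInitialMeasure (HeatFlow.littlewoodOffordProfile β) ν₀ →
      HeatFlow.IsHeatMeasure (HeatFlow.littlewoodOffordProfile β) t νt →
      -- the radial distribution of `ν₀`
      (∀ r ∈ Set.Ioo (0 : ℝ) 1,
        ν₀ {z : ℂ | ‖z‖ ≤ r} = ENNReal.ofReal (r ^ (1 / β))) ∧
      -- `ν_t` is the push-forward of `ν₀` under a measurable map
      Measurable (HeatFlow.modifiedTransportMap β t) ∧
      νt = ν₀.map (HeatFlow.modifiedTransportMap β t) ∧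
      -- the singular part of `ν_t` with respect to the Lebesgue measure on `ℂ`
      νt.singularPart MeasureTheory.volume =
        ENNReal.ofReal (t ^ (1 / (2 * β - 1))) •
          (HeatFlow.semicircleLaw (2 * HeatFlow.collapseRadius β t)).map
            (fun x : ℝ => (x : ℂ)) ∧
      -- the absolutely continuous part of `ν_t` with respect to the Lebesgue measure on `ℂ`
      MeasureTheory.Measure.withDensity MeasureTheory.volume
          (νt.rnDeriv MeasureTheory.volume) =
        (ν₀.restrict {w : ℂ | HeatFlow.collapseRadius β t < ‖w‖ ∧ ‖w‖ < 1}).map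
          (HeatFlow.transportMap β t) := by
  have hβ0 : 0 < β := by linarith
  refine ⟨⟨_, HeatFlow.isInitialMeasure_initialMeasure hβ0, fun ν h => h.eq_initialMeasure hβ0⟩,
    ⟨_, HeatFlow.isHeatMeasure_map_initialMeasure hβ ht, fun ν h => h.eq_map_initialMeasure hβ ht⟩,
    fun ν₀ νt h₀ h => ?_⟩
  obtain rfl := h₀.eq_initialMeasure hβ0
  obtain rfl := h.eq_map_initialMeasure hβ ht
  have hac := HeatFlow.absolutelyContinuous_map_annulus hβ ht
  have hdens := MeasureTheory.Measure.withDensity_rnDeriv_eq _ _ hac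
  have hadd := HeatFlow.map_modifiedTransportMap_eq_add hβ ht
  -- Rewriting the annulus term as a density puts the sum in the form required by uniqueness of the
  -- Lebesgue decomposition.
  rw [← hdens] at hadd
  have hsing := (HeatFlow.mutuallySingular_map_ofReal (HeatFlow.semicircleLaw
    (2 * HeatFlow.collapseRadius β t))).smul (ENNReal.ofReal (t ^ (1 / (2 * β - 1))))
  have hmeas := MeasureTheory.Measure.measurable_rnDeriv
    (((HeatFlow.initialMeasure β).restrict
      {w : ℂ | HeatFlow.collapseRadius β t < ‖w‖ ∧ ‖w‖ < 1}).map (HeatFlow.transportMap β t))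
    MeasureTheory.volume
  refine ⟨fun r hr => HeatFlow.initialMeasure_closedBall hβ0 hr,
    HeatFlow.measurable_modifiedTransportMap β t, rfl, ?_, ?_⟩
  · exact (MeasureTheory.Measure.eq_singularPart hmeas hsing hadd).symm
  · rw [← MeasureTheory.Measure.eq_withDensity_rnDeriv hmeas hsing hadd, hdens]
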